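/- Let $d>1$ be a fundamental discriminant, that is, either $d\equiv 1 \pmod 4$ is squarefree, or $d=4m$ with $m$ squarefree and $m\equiv 2,3\pmod 4$. Let $\chi_d(n)=\left(\frac{d}{n}\right)$ (Kronecker symbol) be the corresponding real primitive Dirichlet character modulo $d$, and $L(s,\chi_d)$ its (entire) Dirichlet $L$-function. Let $\tau>0$ be real, and let $\mathcal{Z}$ be a set of nonempty, pairwise disjoint closed intervals, each of the form $[\gamma_-,\gamma_+]\subseteq[0,\tau]$ or of the form $[-\gamma_0,\gamma_0]\subseteq[-\tau,\tau]$. Suppose that $L(1/2+it,\chi_d)$ has a zero $t$ of odd multiplicity in each interval in $\mathcal{Z}$. Define $$C(\mathcal{Z}):=\sum_{[\gamma_-,\gamma_+]\in\mathcal{Z}}\frac{12}{9+4\gamma_+^2}+\sum_{[-\gamma_0,\gamma_0]\in\mathcal{Z}}\frac{6}{9+4\gamma_0^2},$$ where the first sum is over the intervals of the first form and the second over those of the second form, and, for real $\eta>0$, $$\iota(\eta):=\min\left(\frac{1}{1+\eta^2}+\frac{2}{4+\eta^2},\ \frac{12}{9+4\eta^2}\right).$$ Let $\lambda_0=0.57721566\ldots$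 be the Euler constant. For any real number $\eta>0$, if $$2\,\iota(\eta)+C(\mathcal{Z})>\frac12\log\frac{d}{\pi e^{\lambda_0}}+\frac{L'}{L}(2,\chi_d),$$ then every nontrivial zero $\rho=\beta+i\gamma$ of $L(s,\chi_d)$ (that is, every zero with $0<\beta<1$) with $0<|\gamma|\le\eta$ satisfies $\beta=1/2$. -/

import Mathlib

noncomputable section

open scoped NumberTheorySymbols

/-- Fundamental discriminants: either `D ≡ 1 (mod 4)` is squarefree, or `D = 4 m` with `m`
squarefree and `m ≡ 2, 3 (mod 4)`. -/
def IsFundamentalDiscriminant (D : ℤ) : Prop :=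
  (D % 4 = 1 ∧ Squarefree D) ∨
    ∃ m : ℤ, D = 4 * m ∧ (m % 4 = 2 ∨ m % 4 = 3) ∧ Squarefree m

/-- The Kronecker symbol `(a / n)` for `n ≥ 0`: the completely multiplicative extension in `n` of
the Jacobi symbol, with `(a / 2) = 0` for even `a`, `1` for `a ≡ ±1 (mod 8)` and `-1` for
`a ≡ ±3 (mod 8)` (these are the values of `ZMod.χ₈`), and with `(a / 0) = 1` if `a = ±1` and
`0` otherwise. -/
def kroneckerSym (a : ℤ) (n : ℕ) : ℤ :=
  if n = 0 then (if a.natAbs = 1 then 1 else 0)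
  else ZMod.χ₈ (a : ZMod 8) ^ n.factorization 2 * J(a | ordCompl[2] n)

theorem kroneckerSym_one (a : ℤ) : kroneckerSym a 1 = 1 := by
  simp [kroneckerSym]

theorem kroneckerSym_of_odd (a : ℤ) {n : ℕ} (hn : Odd n) : kroneckerSym a n = J(a | n) := by
  have h0 : n ≠ 0 := by rintro rfl; simp at hn
  have h2 : n.factorization 2 = 0 :=
    Nat.factorization_eq_zero_of_not_dvd (by obtain ⟨k, rfl⟩ := hn; omega)
  simp [kroneckerSym, h0, h2]

theorem kroneckerSym_mul {a : ℤ} {m n : ℕ} (hm : m ≠ 0) (hn : n ≠ 0) :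
    kroneckerSym a (m * n) = kroneckerSym a m * kroneckerSym a n := by
  have h1 : ordCompl[2] m ≠ 0 := (Nat.ordCompl_pos 2 hm).ne'
  have h2 : ordCompl[2] n ≠ 0 := (Nat.ordCompl_pos 2 hn).ne'
  simp only [kroneckerSym, hm, hn, mul_eq_zero, or_self, if_false]
  rw [Nat.ordCompl_mul, jacobiSym.mul_right' a h1 h2, Nat.factorization_mul hm hn,
    Finsupp.add_apply, pow_add]
  ring

/-- For a positive `d ≡ 1 (mod 4)`, the Kronecker symbol `(d / n)` is the Jacobi symbol
`(n / d)`. -/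
theorem kroneckerSym_eq_jacobiSym {d : ℕ} (hd : d % 4 = 1) (n : ℕ) :
    kroneckerSym d n = J((n : ℤ) | d) := by
  have hodd : Odd d := Nat.odd_iff.2 (by omega)
  rcases eq_or_ne n 0 with rfl | hn
  · rcases eq_or_ne d 1 with rfl | h1
    · simp [kroneckerSym]
    · rw [Nat.cast_zero, jacobiSym.zero_left (by omega)]
      simp [kroneckerSym, h1]
  · have hc : Odd (ordCompl[2] n) :=
      Nat.odd_iff.2 (Nat.two_dvd_ne_zero.1 (Nat.not_dvd_ordCompl Nat.prime_two hn))
    have key : (n : ℤ) = (2 : ℤ) ^ n.factorization 2 * ((ordCompl[2] n : ℕ) : ℤ) := by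
      exact_mod_cast (Nat.ordProj_mul_ordCompl_eq_self n 2).symm
    have hR : J((n : ℤ) | d) =
        J(2 | d) ^ n.factorization 2 * J(((ordCompl[2] n : ℕ) : ℤ) | d) := by
      conv_lhs => rw [key]
      rw [jacobiSym.mul_left, jacobiSym.pow_left]
    rw [hR, jacobiSym.at_two hodd, ← jacobiSym.quadratic_reciprocity_one_mod_four hd hc]
    simp [kroneckerSym, hn]

/-- For a multiple `d` of `4`, the Kronecker symbol `(d / n)` vanishes at even `n`. -/
theorem kroneckerSym_even {m n : ℕ} (hn : Even n) :
    kroneckerSym ((4 * m : ℕ) : ℤ) n = 0 := by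
  rcases eq_or_ne n 0 with rfl | h0
  · have : (4 * m : ℕ) ≠ 1 := by omega
    simp only [kroneckerSym, if_true, Int.natAbs_natCast, this, if_false]
  · have hf : n.factorization 2 ≠ 0 :=
      (Nat.prime_two.factorization_pos_of_dvd h0 hn.two_dvd).ne'
    have hc : ZMod.χ₈ (((4 * m : ℕ) : ℤ) : ZMod 8) = 0 := by
      rw [ZMod.χ₈_int_eq_if_mod_eight, if_pos (by omega)]
    rw [kroneckerSym, if_neg h0, hc, zero_pow hf, zero_mul]

theorem IsFundamentalDiscriminant.mod_four {d : ℕ} (hd : IsFundamentalDiscriminant (d : ℤ)) :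
    d % 4 = 1 ∨ ∃ m : ℕ, d = 4 * m := by
  rcases hd with ⟨h, -⟩ | ⟨m, h, h', -⟩
  · left; omega
  · right; exact ⟨m.toNat, by omega⟩

/-- Periodicity of the Kronecker symbol of a positive fundamental discriminant. -/
theorem kroneckerSym_mod {d : ℕ} (hd : IsFundamentalDiscriminant (d : ℤ)) (n : ℕ) :
    kroneckerSym d (n % d) = kroneckerSym d n := by
  rcases hd.mod_four with h | ⟨m, rfl⟩
  · rw [kroneckerSym_eq_jacobiSym h, kroneckerSym_eq_jacobiSym h, Int.natCast_mod,
      ← jacobiSym.mod_left]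
  · have hpar : n % (4 * m) % 2 = n % 2 := Nat.mod_mod_of_dvd n ⟨2 * m, by ring⟩
    rcases Nat.even_or_odd n with hn | hn
    · rw [kroneckerSym_even hn,
        kroneckerSym_even (Nat.even_iff.2 (hpar.trans (Nat.even_iff.1 hn)))]
    · have hn' : Odd (n % (4 * m)) := Nat.odd_iff.2 (hpar.trans (Nat.odd_iff.1 hn))
      have h4 (k : ℕ) (hk : Odd k) : J(((4 * m : ℕ) : ℤ) | k) = J((m : ℤ) | k) := by
        push_cast
        rw [jacobiSym.mul_left, jacobiSym.at_four hk, one_mul]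
      rw [kroneckerSym_of_odd _ hn, kroneckerSym_of_odd _ hn', h4 _ hn, h4 _ hn',
        ← jacobiSym.mod_right' m hn]

theorem kroneckerSym_eq_zero {d : ℕ} (hd : IsFundamentalDiscriminant (d : ℤ)) {n : ℕ}
    (hn : ¬ n.Coprime d) : kroneckerSym d n = 0 := by
  rcases hd.mod_four with h | ⟨m, rfl⟩
  · rw [kroneckerSym_eq_jacobiSym h, jacobiSym.eq_zero_iff]
    exact ⟨by omega, by rwa [Int.gcd_natCast_natCast]⟩
  · rcases Nat.even_or_odd n with he | ho
    · exact kroneckerSym_even he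
    · rw [kroneckerSym_of_odd _ ho, jacobiSym.eq_zero_iff]
      refine ⟨by rintro rfl; simp at ho, ?_⟩
      rw [Int.gcd_natCast_natCast, Nat.gcd_comm]
      exact hn

/-- The real primitive character `χ_d` modulo a positive fundamental discriminant `d`, given by
the Kronecker symbol: `χ_d (n) = (d / n)`. -/
def kroneckerChar (d : ℕ) [NeZero d] (hd : IsFundamentalDiscriminant (d : ℤ)) :
    DirichletCharacter ℂ d where
  toFun x := (kroneckerSym d x.val : ℂ)
  map_one' := by
    rw [ZMod.val_one_eq_one_mod, kroneckerSym_mod hd, kroneckerSym_one, Int.cast_one]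
  map_mul' x y := by
    rcases eq_or_ne d 1 with rfl | h1
    · have h (z : ZMod 1) : z.val = 0 := by
        have := ZMod.val_lt z
        omega
      simp [h, kroneckerSym]
    have h0 : kroneckerSym d 0 = 0 := by simp [kroneckerSym, h1]
    rw [ZMod.val_mul, kroneckerSym_mod hd, ← Int.cast_mul]
    congr 1
    rcases eq_or_ne x.val 0 with hx | hx
    · rw [hx, zero_mul, h0, zero_mul]
    rcases eq_or_ne y.val 0 with hy | hy
    · rw [hy, mul_zero, h0, mul_zero]
    exact kroneckerSym_mul hx hy
  map_nonunit' x hx := by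
    have hc : ¬ x.val.Coprime d := by
      rwa [← ZMod.isUnit_iff_coprime, ZMod.natCast_zmod_val]
    simp [kroneckerSym_eq_zero hd hc]

theorem kroneckerChar_natCast (d : ℕ) [NeZero d] (hd : IsFundamentalDiscriminant (d : ℤ))
    (n : ℕ) : kroneckerChar d hd (n : ZMod d) = (kroneckerSym d n : ℂ) := by
  change ((kroneckerSym d (n : ZMod d).val : ℤ) : ℂ) = _
  rw [ZMod.val_natCast, kroneckerSym_mod hd]

/-- `f` has a zero of odd multiplicity at `z`. -/
def HasOddZeroAt (f : ℂ → ℂ) (z : ℂ) : Prop :=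
  ∃ m : ℕ, Odd m ∧ analyticOrderAt f z = m

/-- A nontrivial zero of a Dirichlet `L`-function, i.e. a zero in the critical strip. -/
def IsNontrivialZero {N : ℕ} [NeZero N] (χ : DirichletCharacter ℂ N) (ρ : ℂ) : Prop :=
  χ.LFunction ρ = 0 ∧ 0 < ρ.re ∧ ρ.re < 1

/-- The quantity `ι(η)`. -/
def iotaMin (η : ℝ) : ℝ :=
  min (1 / (1 + η ^ 2) + 2 / (4 + η ^ 2)) (12 / (9 + 4 * η ^ 2))

/-- An admissible interval: `[γ₋, γ₊] ⊆ [0, τ]` or `[-γ₀, γ₀] ⊆ [-τ, τ]`. -/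
def IsAdmissibleInterval (τ : ℝ) (I : NonemptyInterval ℝ) : Prop :=
  Set.Icc I.fst I.snd ⊆ Set.Icc 0 τ ∨
    (I.fst = -I.snd ∧ Set.Icc I.fst I.snd ⊆ Set.Icc (-τ) τ)

/-- The contribution `C(𝒵)`: the sum of `12 / (9 + 4 γ₊²)` over the intervals `[γ₋, γ₊]` with
`γ₋ ≥ 0`, plus the sum of `6 / (9 + 4 γ₀²)` over the symmetric intervals `[-γ₀, γ₀]`. -/
def knownContribution (Z : Set (NonemptyInterval ℝ)) : ℝ :=
  (∑ᶠ I ∈ {I ∈ Z | 0 ≤ I.fst}, 12 / (9 + 4 * I.snd ^ 2)) +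
    ∑ᶠ I ∈ {I ∈ Z | I.fst = -I.snd}, 6 / (9 + 4 * I.snd ^ 2)

end

/-! Put `Λ` for the completed `L`-function and `ξ(w) = d^(w/2) Λ(1/2 + w, χ_d)`. Three facts make
`ξ` usable: it is entire, it is even (the root number of `χ_d` is `1`), and its zeros lie in `|Re w|
< 1/2`; they are exactly the nontrivial zeros of `L`, shifted by `1/2`.

Since `ξ` is even of order less than two, `ξ'/ξ(3/2)` dominates the sum of `Re (1/(3/2 - a) + 1/(3/2
+ a))` over any finite set of zeros `a` in the upper half-plane: all these terms are positive, so
omitting zeros only lowers the sum (`sum_re_le_re_logDeriv`). By the definition of `ξ`, with `Γ'(1)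
= -λ₀`, the same value is the right-hand side of the hypothesis (`re_logDeriv_kroneckerXi`).

Each interval of `Z` that is counted supplies a zero `iu` with `u > 0`, which contributes `12 / (9 +
4u²)`; together they pay for `C(Z)`. A zero `x + ig` with `x ≠ 0` and `0 < |g| ≤ η` brings, by
evenness and conjugation, both `x + i|g|` and `-x + i|g|`, each contributing at least `ι(η)`
(`iotaMin_le`). An off-line zero would thus force `2ι(η) + C(Z)` to be at most the right-hand side,
against the hypothesis.

The root number is obtained from quadratic Gauss sums: their value comes from comparing a theta
constant at two cusps (`sum_exp_sq_eq`), prime moduli are glued by quadratic reciprocity, and the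
factors at `2` are checked from tables (`isSelfDual_kroneckerSym`). -/

open scoped NumberTheorySymbols

/-! ### Zeros and logarithmic derivatives of even entire functions of order less than two. -/

open Complex Metric Filter Topology Set in
/-- An entire function that is not identically zero splits off the full power of `w - a`. -/
theorem Differentiable.exists_eq_pow_mul {F : ℂ → ℂ} (hF : Differentiable ℂ F) {x : ℂ}
    (hx : F x ≠ 0) (a : ℂ) :
    ∃ (m : ℕ) (G : ℂ → ℂ), Differentiable ℂ G ∧ G a ≠ 0 ∧ ∀ w, F w = (w - a) ^ m * G w := by
  have han : AnalyticOnNhd ℂ F univ := hF.differentiableOn.analyticOnNhd isOpen_univ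
  have htop : analyticOrderAt F a ≠ ⊤ := by
    intro h
    rw [analyticOrderAt_eq_top] at h
    exact hx (han.eqOn_zero_of_preconnected_of_eventuallyEq_zero isPreconnected_univ
      (mem_univ a) h (mem_univ x))
  obtain ⟨g, hg, hga, hFg⟩ := (han a (mem_univ a)).analyticOrderAt_ne_top.1 htop
  set m := analyticOrderNatAt F a
  -- The quotient has a removable singularity at `a`, filled with the value of the local cofactor
  -- `g`.
  refine ⟨m, Function.update (fun w => F w / (w - a) ^ m) a (g a), ?_, by simpa using hga, ?_⟩
  · intro w
    rcases eq_or_ne w a with rfl | hw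
    · refine hg.differentiableAt.congr_of_eventuallyEq ?_
      filter_upwards [hFg] with z hz
      rcases eq_or_ne z w with rfl | hzw
      · simp
      · rw [Function.update_of_ne hzw, hz, smul_eq_mul,
          mul_div_cancel_left₀ _ (pow_ne_zero _ (sub_ne_zero.2 hzw))]
    · have : DifferentiableAt ℂ (fun w => F w / (w - a) ^ m) w :=
        (hF w).div (by fun_prop) (pow_ne_zero _ (sub_ne_zero.2 hw))
      refine this.congr_of_eventuallyEq ?_
      filter_upwards [isOpen_ne.mem_nhds hw] with z hz
      rw [Function.update_of_ne hz]
  · intro w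
    rcases eq_or_ne w a with rfl | hw
    · simpa using hFg.self_of_nhds
    · rw [Function.update_of_ne hw, mul_div_cancel₀ _ (pow_ne_zero _ (sub_ne_zero.2 hw))]

open Complex Metric Filter Topology Set in
/-- An entire function splits off finitely many of its zeros. -/
theorem Differentiable.exists_eq_prod_pow_mul {F : ℂ → ℂ} (hF : Differentiable ℂ F) {x : ℂ}
    (hx : F x ≠ 0) (s : Finset ℂ) :
    ∃ (m : ℂ → ℕ) (G : ℂ → ℂ), Differentiable ℂ G ∧ (∀ a ∈ s, G a ≠ 0) ∧
      ∀ w, F w = (∏ a ∈ s, (w - a) ^ m a) * G w := by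
  classical
  induction s using Finset.induction_on with
  | empty => exact ⟨0, F, hF, by simp, by simp⟩
  | insert a s ha ih =>
    obtain ⟨m, G, hG, hG0, hFG⟩ := ih
    have hGx : G x ≠ 0 := fun h => hx (by rw [hFG, h, mul_zero])
    obtain ⟨k, H, hH, hHa, hGH⟩ := hG.exists_eq_pow_mul hGx a
    refine ⟨Function.update m a k, H, hH, ?_, fun w => ?_⟩
    · intro b hb
      rcases Finset.mem_insert.1 hb with rfl | hb
      · exact hHa
      · intro h
        exact hG0 b hb (by rw [hGH, h, mul_zero])
    · rw [Finset.prod_insert ha, hFG, hGH, Function.update_self]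
      have : ∏ b ∈ s, (w - b) ^ Function.update m a k b = ∏ b ∈ s, (w - b) ^ m b :=
        Finset.prod_congr rfl fun b hb => by
          rw [Function.update_of_ne (by rintro rfl; exact ha hb)]
      rw [this]
      ring

open Complex Metric Filter Topology Set in
theorem Differentiable.finite_zeros_of_isCompact {F : ℂ → ℂ} (hF : Differentiable ℂ F) {x : ℂ}
    (hx : F x ≠ 0) {K : Set ℂ} (hK : IsCompact K) : (K ∩ F ⁻¹' {0}).Finite := by
  have han : AnalyticOnNhd ℂ F univ := hF.differentiableOn.analyticOnNhd isOpen_univ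
  have hcod : F ⁻¹' {0}ᶜ ∈ codiscrete ℂ := han.preimage_zero_mem_codiscrete hx
  rw [preimage_compl] at hcod
  have h := mem_codiscrete'.mp hcod
  rw [compl_compl] at h
  apply (hK.inter_right (isOpen_compl_iff.1 h.1)).finite
  exact h.2.mono inter_subset_right

open Complex Metric Filter Topology Set in
/-- A zero-free holomorphic function on a disc is the exponential of a holomorphic function. -/
theorem exists_exp_eq_of_ne_zero_on_ball {K : ℂ → ℂ} {c : ℂ} {R : ℝ} (hR : 0 < R)
    (hK : DifferentiableOn ℂ K (ball c R)) (h0 : ∀ w ∈ ball c R, K w ≠ 0) (hc : K c = 1) :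
    ∃ l : ℂ → ℂ, l c = 0 ∧ (∀ w ∈ ball c R, HasDerivAt l (logDeriv K w) w) ∧
      ∀ w ∈ ball c R, exp (l w) = K w := by
  have hKd : ∀ w ∈ ball c R, DifferentiableAt ℂ K w := fun w hw =>
    hK.differentiableAt (isOpen_ball.mem_nhds hw)
  have hd : DifferentiableOn ℂ (logDeriv K) (ball c R) :=
    (hK.deriv isOpen_ball).div hK h0
  obtain ⟨l, hlc, hl⟩ := hd.isExactOn_ball.with_val_at c 0
  refine ⟨l, hlc, hl, fun w hw => ?_⟩
  -- `l` is the primitive of `K'/K` vanishing at `c`, so `K exp(-l)` has zero derivative and keeps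
  -- its value `1`.
  have hcon : ∀ z ∈ ball c R, HasDerivAt (fun z => K z * exp (-l z)) 0 z := by
    intro z hz
    have h1 := (hKd z hz).hasDerivAt.mul ((hl z hz).neg.cexp)
    refine h1.congr_deriv ?_
    have := h0 z hz
    rw [logDeriv_apply]
    field_simp
    ring
  have hcst : K w * exp (-l w) = K c * exp (-l c) := by
    refine isOpen_ball.is_const_of_deriv_eq_zero (convex_ball c R).isPreconnected
      (fun z hz => (hcon z hz).differentiableAt.differentiableWithinAt)
      (fun z hz => (hcon z hz).deriv) hw (mem_ball_self hR)
  rw [hlc, hc, exp_neg, neg_zero, exp_zero, mul_one] at hcst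
  field_simp at hcst
  exact hcst.symm

open Complex Metric Filter Topology Set in
/-- A logarithmic derivative of a zero-free function of bounded growth on a large disc varies
little near the centre. -/
theorem norm_logDeriv_sub_le {K : ℂ → ℂ} {c z : ℂ} {R M : ℝ} (hR : 0 < R) (hM : 0 < M)
    (hK : DifferentiableOn ℂ K (ball c R)) (h0 : ∀ w ∈ ball c R, K w ≠ 0) (hc : K c = 1)
    (hb : ∀ w ∈ ball c R, ‖K w‖ ≤ Real.exp M) (hz : ‖z - c‖ < R / 8) :
    ‖logDeriv K z - logDeriv K c‖ ≤ 64 * M / R ^ 2 * ‖z - c‖ := by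
  obtain ⟨l, hlc, hl, hexp⟩ := exists_exp_eq_of_ne_zero_on_ball hR hK h0 hc
  have hld : DifferentiableOn ℂ l (ball c R) := fun w hw =>
    (hl w hw).differentiableAt.differentiableWithinAt
  have hre : ∀ w ∈ ball c R, (l w).re ≤ M := by
    intro w hw
    have := hb w hw
    rw [← hexp w hw, norm_exp] at this
    exact Real.exp_le_exp.1 this
  have hmaps : MapsTo (fun w => w + c) (ball 0 R) (ball c R) := by
    intro w hw
    simpa [mem_ball, dist_eq_norm] using hw
  -- The radius shrinks three times: Borel–Carathéodory on `R/2` turns the bound on `Re l` into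
  -- `2M`, Cauchy's estimate on discs of radius `R/4` gives `8M/R` for `l'`, and on discs of radius
  -- `R/8` gives `64M/R²` for `l''`.
  have hl1 : ∀ w ∈ closedBall c (R / 2), ‖l w‖ ≤ 2 * M := by
    intro w hw
    have hw' : ‖w - c‖ ≤ R / 2 := by simpa [dist_eq_norm] using hw
    have h := borelCaratheodory_zero (f := fun w => l (w + c)) (R := R) (z := w - c) hM
      (hld.comp (by fun_prop) hmaps) (fun u hu => hre _ (hmaps hu)) hR
      (by rw [mem_ball_zero_iff]; linarith) (by simpa using hlc)
    rw [sub_add_cancel] at h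
    refine h.trans ?_
    rw [div_le_iff₀ (by linarith)]
    nlinarith
  have hl2 : ∀ w ∈ closedBall c (R / 4), ‖logDeriv K w‖ ≤ 8 * M / R := by
    intro w hw
    have hw' : dist w c ≤ R / 4 := hw
    have hsub : closedBall w (R / 4) ⊆ closedBall c (R / 2) :=
      closedBall_subset_closedBall' (by linarith)
    have hsub' : closedBall c (R / 2) ⊆ ball c R := closedBall_subset_ball (by linarith)
    rw [← (hl w (hsub' (hsub (mem_closedBall_self (by linarith))))).deriv]
    have h := norm_deriv_le_of_forall_mem_sphere_norm_le (f := l) (c := w) (R := R / 4)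
      (C := 2 * M) (by linarith)
      ((hld.mono (hsub.trans hsub')).diffContOnCl_ball subset_rfl)
      (fun u hu => hl1 u (hsub (sphere_subset_closedBall hu)))
    refine h.trans (le_of_eq ?_)
    field_simp
    norm_num
  have hd : DifferentiableOn ℂ (logDeriv K) (ball c R) :=
    (hK.deriv isOpen_ball).div hK h0
  have hl3 : ∀ w ∈ ball c (R / 8), ‖deriv (logDeriv K) w‖ ≤ 64 * M / R ^ 2 := by
    intro w hw
    have hw' : dist w c < R / 8 := hw
    have hsub : closedBall w (R / 8) ⊆ closedBall c (R / 4) :=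
      closedBall_subset_closedBall' (by linarith)
    have hsub' : closedBall c (R / 4) ⊆ ball c R := closedBall_subset_ball (by linarith)
    have h := norm_deriv_le_of_forall_mem_sphere_norm_le (f := logDeriv K) (c := w) (R := R / 8)
      (C := 8 * M / R) (by linarith)
      ((hd.mono (hsub.trans hsub')).diffContOnCl_ball subset_rfl)
      (fun u hu => hl2 u (hsub (sphere_subset_closedBall hu)))
    refine h.trans (le_of_eq ?_)
    field_simp
    norm_num
  exact (convex_ball c (R / 8)).norm_image_sub_le_of_norm_deriv_le
    (fun w hw => hd.differentiableAt (isOpen_ball.mem_nhds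
      (ball_subset_ball (by linarith) hw))) hl3
    (mem_ball_self (by linarith)) (by rwa [mem_ball, dist_eq_norm])

theorem logDeriv_neg_of_even {F : ℂ → ℂ} (hF : ∀ w, F (-w) = F w) (w : ℂ) :
    logDeriv F (-w) = -logDeriv F w := by
  have h : deriv F (-w) = -deriv F w := by
    have h1 : (fun w => F (-w)) = F := funext hF
    have h2 := deriv_comp_neg F w
    rw [h1] at h2
    rw [h2, neg_neg]
  rw [logDeriv_apply, logDeriv_apply, hF, h, neg_div]

open Complex in
theorem re_one_div_pos_of_re_pos {z : ℂ} (hz : 0 < z.re) : 0 < (1 / z).re := by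
  rw [one_div, inv_re]
  exact div_pos hz (normSq_pos.2 (by rintro rfl; simp at hz))

open Complex Metric Filter Topology Set in
/-- The logarithmic derivative of an even entire function of order less than two with zeros in a
vertical strip, compared with a partial sum over its zeros. -/
theorem sum_re_le_re_logDeriv_add {F : ℂ → ℂ} (hF : Differentiable ℂ F)
    (heven : ∀ w, F (-w) = F w) {C : ℝ} (hC : 0 ≤ C)
    (hgrowth : ∀ w, ‖F w‖ ≤ Real.exp (C * (1 + ‖w‖) ^ (3 / 2 : ℝ)))
    {x : ℝ} (hx : 0 < x) (hzero : ∀ a, F a = 0 → |a.re| < x)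
    (S : Finset ℂ) (hS : ∀ a ∈ S, F a = 0) {R : ℝ} (hR : 16 * x < R)
    (hSR : ∀ a ∈ S, dist a x ≤ R) :
    ∑ a ∈ S, ((1 / (x - a)).re + (1 / (x + a)).re) / 2 ≤ (logDeriv F x).re +
      64 * (C * (1 + 5 * R) ^ (3 / 2 : ℝ) + (|Real.log ‖F x‖| + 1)) / R ^ 2 * x := by
  have hR0 : 0 < R := by linarith
  have hFx : F x ≠ 0 := fun h => by
    have := hzero _ h
    rw [ofReal_re, abs_of_pos hx] at this
    exact lt_irrefl _ this
  have hfin := hF.finite_zeros_of_isCompact hFx (isCompact_closedBall (x : ℂ) R)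
  set s := hfin.toFinset with hs
  have hmem : ∀ a, a ∈ s ↔ dist a x ≤ R ∧ F a = 0 := by
    intro a
    simp [hs]
  obtain ⟨m, G, hG, hG0, hFG⟩ := hF.exists_eq_prod_pow_mul hFx s
  have hGx : G x ≠ 0 := fun h => hFx (by rw [hFG, h, mul_zero])
  have hGball : ∀ w ∈ ball (x : ℂ) R, G w ≠ 0 := by
    intro w hw h
    exact hG0 w ((hmem w).2 ⟨(mem_ball.1 hw).le, by rw [hFG, h, mul_zero]⟩) h
  -- The first term bounds `log ‖F‖` on the circle of radius `4R` about `x`, the second pays for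
  -- dividing by `F x`; the `+ 1` only keeps `M` positive.
  set M := C * (1 + 5 * R) ^ (3 / 2 : ℝ) + (|Real.log ‖F x‖| + 1) with hMdef
  have hM : 0 < M := by positivity
  have hFx0 : 0 < ‖F x‖ := norm_pos_iff.2 hFx
  set K : ℂ → ℂ := fun w => G w / G x with hKdef
  have hKd : Differentiable ℂ K := hG.div_const _
  have hPx : 0 < ‖∏ a ∈ s, ((x : ℂ) - a) ^ m a‖ :=
    norm_pos_iff.2 fun h => hFx (by rw [hFG, h, zero_mul])
  have hKb : ∀ w ∈ ball (x : ℂ) R, ‖K w‖ ≤ Real.exp M := by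
    intro w hw
    -- Maximum principle on the disc of radius `4R`: on its boundary every removed zero `a` has `‖z
    -- - a‖ ≥ 3R ≥ ‖x - a‖`, so there `‖K z‖ ≤ ‖F z‖ / ‖F x‖`.
    refine norm_le_of_forall_mem_frontier_norm_le (U := ball (x : ℂ) (4 * R)) isBounded_ball
      hKd.diffContOnCl (fun z hz => ?_) (subset_closure (ball_subset_ball (by linarith) hw))
    rw [frontier_ball _ (by linarith)] at hz
    have hz' : ‖z - x‖ = 4 * R := by simpa [dist_eq_norm] using hz
    have hzn : ‖z‖ ≤ 5 * R := by
      have h1 : ‖z‖ ≤ ‖z - x‖ + ‖(x : ℂ)‖ := by simpa using norm_add_le (z - x) (x : ℂ)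
      rw [norm_real, Real.norm_eq_abs, abs_of_pos hx] at h1
      linarith
    have hP : ‖∏ a ∈ s, ((x : ℂ) - a) ^ m a‖ ≤ ‖∏ a ∈ s, (z - a) ^ m a‖ := by
      rw [norm_prod, norm_prod]
      refine Finset.prod_le_prod (fun _ _ => norm_nonneg _) fun a ha => ?_
      rw [norm_pow, norm_pow]
      gcongr
      have ha' : ‖(x : ℂ) - a‖ ≤ R := by
        rw [norm_sub_rev, ← dist_eq_norm]
        exact ((hmem a).1 ha).1
      have := norm_sub_le_norm_sub_add_norm_sub z a (x : ℂ)
      rw [norm_sub_rev a] at this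
      linarith
    have hFz : ‖F z‖ ≤ Real.exp (C * (1 + 5 * R) ^ (3 / 2 : ℝ)) :=
      (hgrowth z).trans (Real.exp_le_exp.2 (by gcongr))
    have hlog : 1 / ‖F x‖ ≤ Real.exp (|Real.log ‖F x‖| + 1) := by
      rw [one_div, ← Real.exp_log (inv_pos.2 hFx0), Real.log_inv]
      exact Real.exp_le_exp.2 (by linarith [neg_le_abs (Real.log ‖F x‖)])
    have hGz : ‖G z‖ * ‖∏ a ∈ s, (z - a) ^ m a‖ = ‖F z‖ := by
      rw [hFG z, norm_mul, mul_comm]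
    have hGx' : ‖G x‖ * ‖∏ a ∈ s, ((x : ℂ) - a) ^ m a‖ = ‖F x‖ := by
      rw [hFG x, norm_mul, mul_comm]
    calc ‖K z‖ = ‖G z‖ / ‖G x‖ := norm_div _ _
      _ ≤ ‖F z‖ / ‖F x‖ := by
        rw [div_le_div_iff₀ (norm_pos_iff.2 hGx) hFx0, ← hGz, ← hGx']
        have := mul_le_mul_of_nonneg_left hP (mul_nonneg (norm_nonneg (G z)) (norm_nonneg (G x)))
        linarith
      _ = ‖F z‖ * (1 / ‖F x‖) := by ring
      _ ≤ Real.exp M := by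
        rw [hMdef, Real.exp_add]
        gcongr
  have hsum : ∀ w : ℂ, F w ≠ 0 → logDeriv F w = ∑ a ∈ s, m a * (1 / (w - a)) + logDeriv K w := by
    intro w hw
    have hPw : ∏ a ∈ s, (w - a) ^ m a ≠ 0 := fun h => hw (by rw [hFG, h, zero_mul])
    have hGw : G w ≠ 0 := fun h => hw (by rw [hFG, h, mul_zero])
    have hne : ∀ a ∈ s, (w - a) ^ m a ≠ 0 := Finset.prod_ne_zero_iff.1 hPw
    have h1 : F = fun w => (∏ a ∈ s, (w - a) ^ m a) * G w := funext hFG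
    have h2 : logDeriv K w = logDeriv G w := by
      simp only [hKdef, div_eq_mul_inv]
      exact logDeriv_mul_const w _ (inv_ne_zero hGx)
    rw [h1, logDeriv_mul w hPw hGw (by fun_prop) (hG w), h2,
      logDeriv_prod hne (fun _ _ => by fun_prop)]
    congr 1
    refine Finset.sum_congr rfl fun a _ => ?_
    rw [logDeriv_fun_pow (by fun_prop)]
    congr 1
    rw [logDeriv_apply, deriv_sub_const, deriv_id'']
  have hFnx : F (-x) ≠ 0 := by rwa [heven]
  have hK1 : K x = 1 := div_self hGx
  have hKne : ∀ w ∈ ball (x : ℂ) R, K w ≠ 0 := fun w hw => div_ne_zero (hGball w hw) hGx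
  have hnx : ‖-(x : ℂ) - x‖ = 2 * x := by
    rw [← neg_add', norm_neg, ← two_mul, norm_mul, norm_real, Real.norm_eq_abs, abs_of_pos hx]
    simp
  -- Comparing the points `x` and `-x`, where `F'/F` takes opposite values, eliminates the constant
  -- term of a Hadamard product. Their distance `2x` is below `R/8` because `16x < R`.
  have hvar := norm_logDeriv_sub_le hR0 hM hKd.differentiableOn hKne hK1 hKb
    (z := -(x : ℂ)) (by rw [hnx]; linarith)
  rw [hnx] at hvar
  have hre := (abs_re_le_norm _).trans hvar
  have e1 := congrArg re (hsum x hFx)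
  have e2 := congrArg re (hsum (-x) hFnx)
  rw [logDeriv_neg_of_even heven] at e2
  simp only [add_re, re_sum, neg_re] at e1 e2
  have hterm : ∀ a ∈ s, 0 < (1 / ((x : ℂ) - a)).re ∧ 0 < (1 / ((x : ℂ) + a)).re := by
    intro a ha
    have := abs_lt.1 (hzero a ((hmem a).1 ha).2)
    exact ⟨re_one_div_pos_of_re_pos (by simp; linarith),
      re_one_div_pos_of_re_pos (by simp; linarith)⟩
  have hcast : ∀ (n : ℕ) (z : ℂ), ((n : ℂ) * z).re = n * z.re := fun n z => by
    rw [← ofReal_natCast, re_ofReal_mul]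
  have hneg : ∀ a : ℂ, (1 / (-(x : ℂ) - a)).re = -(1 / (x + a)).re := by
    intro a
    rw [← neg_add', one_div, inv_neg, neg_re, one_div]
  simp only [hcast, hneg] at e1 e2
  have hS_le : ∑ a ∈ S, ((1 / ((x : ℂ) - a)).re + (1 / (x + a)).re) / 2 ≤
      ∑ a ∈ s, m a * (((1 / ((x : ℂ) - a)).re + (1 / (x + a)).re) / 2) := by
    have hsub : S ⊆ s := fun a ha => (hmem a).2 ⟨hSR a ha, hS a ha⟩
    refine (Finset.sum_le_sum fun a ha => ?_).trans
      (Finset.sum_le_sum_of_subset_of_nonneg hsub fun a ha _ => ?_)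
    · have hm : 1 ≤ m a := by
        refine Nat.one_le_iff_ne_zero.2 fun h => ?_
        have hF0 := hS a ha
        rw [hFG, mul_eq_zero, or_iff_left (hG0 a (hsub ha)), Finset.prod_eq_zero_iff] at hF0
        obtain ⟨b, hb, hb0⟩ := hF0
        have hab : a = b := by
          by_contra hne
          exact pow_ne_zero _ (sub_ne_zero.2 hne) hb0
        subst hab
        simp [h] at hb0
      have := hterm a (hsub ha)
      have hm' : (1 : ℝ) ≤ m a := by exact_mod_cast hm
      exact le_mul_of_one_le_left (by linarith) hm'
    · have := hterm a ha
      exact mul_nonneg (Nat.cast_nonneg _) (by linarith)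
  have hsplit : ∑ a ∈ s, m a * (((1 / ((x : ℂ) - a)).re + (1 / (x + a)).re) / 2) =
      (∑ a ∈ s, m a * (1 / ((x : ℂ) - a)).re + ∑ a ∈ s, m a * (1 / ((x : ℂ) + a)).re) / 2 := by
    rw [← Finset.sum_add_distrib, Finset.sum_div]
    exact Finset.sum_congr rfl fun a _ => by ring
  have e2' : -(logDeriv F x).re =
      -(∑ a ∈ s, m a * (1 / ((x : ℂ) + a)).re) + (logDeriv K (-x)).re := by
    rw [e2, ← Finset.sum_neg_distrib]
    simp only [mul_neg]
  rw [sub_re] at hre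
  have := abs_le.1 hre
  have h3 : 64 * M / R ^ 2 * (2 * x) = 2 * (64 * M / R ^ 2 * x) := by ring
  rw [h3] at this
  linarith [this.1, this.2]

open Complex Metric Filter Topology Set in
/-- For an even entire function of order less than two with zeros in a vertical strip, the partial
sums over zeros of its logarithmic derivative are bounded by the logarithmic derivative. -/
theorem sum_re_le_re_logDeriv {F : ℂ → ℂ} (hF : Differentiable ℂ F)
    (heven : ∀ w, F (-w) = F w) {C : ℝ} (hC : 0 ≤ C)
    (hgrowth : ∀ w, ‖F w‖ ≤ Real.exp (C * (1 + ‖w‖) ^ (3 / 2 : ℝ)))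
    {x : ℝ} (hx : 0 < x) (hzero : ∀ a, F a = 0 → |a.re| < x)
    (S : Finset ℂ) (hS : ∀ a ∈ S, F a = 0) :
    ∑ a ∈ S, ((1 / (x - a)).re + (1 / (x + a)).re) / 2 ≤ (logDeriv F x).re := by
  set c := |Real.log ‖F x‖| + 1
  have hc : 0 < c := by positivity
  -- The error is `O(R^(3/2) / R²)`, and it vanishes as `R → ∞` because the growth exponent `3/2` is
  -- below `2`.
  have hlim : Tendsto (fun R : ℝ => (logDeriv F x).re +
      64 * (C * 36 * R ^ (-(1 / 2) : ℝ) + c * R ^ (-2 : ℝ)) * x) atTop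
      (𝓝 ((logDeriv F x).re + 64 * (C * 36 * 0 + c * 0) * x)) := by
    have h1 := tendsto_rpow_neg_atTop (y := 1 / 2) (by norm_num)
    have h2 := tendsto_rpow_neg_atTop (y := 2) (by norm_num)
    exact ((((h1.const_mul _).add (h2.const_mul _)).const_mul _).mul_const _).const_add _
  rw [mul_zero, mul_zero, add_zero, mul_zero, zero_mul, add_zero] at hlim
  refine ge_of_tendsto hlim ?_
  have hev : ∀ᶠ R : ℝ in atTop, ∀ a ∈ S, dist a x ≤ R :=
    (Filter.eventually_all_finset S).2 fun a _ => eventually_ge_atTop _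
  filter_upwards [hev, eventually_gt_atTop (16 * x), eventually_ge_atTop 1] with R h1 h2 h3
  refine (sum_re_le_re_logDeriv_add hF heven hC hgrowth hx hzero S hS h2 h1).trans ?_
  have hR0 : 0 < R := by linarith
  have e1 : (1 + 5 * R) ^ (3 / 2 : ℝ) ≤ 36 * R ^ (3 / 2 : ℝ) := by
    have h36 : (36 : ℝ) = 6 * 6 := by norm_num
    calc (1 + 5 * R) ^ (3 / 2 : ℝ) ≤ (6 * R) ^ (3 / 2 : ℝ) := by gcongr; linarith
      _ = 6 ^ (3 / 2 : ℝ) * R ^ (3 / 2 : ℝ) := Real.mul_rpow (by norm_num) hR0.le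
      _ ≤ 6 ^ (2 : ℝ) * R ^ (3 / 2 : ℝ) := by
        gcongr
        · norm_num
        · norm_num
      _ = 36 * R ^ (3 / 2 : ℝ) := by norm_num
  have e2 : R ^ (3 / 2 : ℝ) / R ^ 2 = R ^ (-(1 / 2) : ℝ) := by
    rw [← Real.rpow_natCast R 2, ← Real.rpow_sub hR0]
    norm_num
  have e3 : 1 / R ^ 2 = R ^ (-2 : ℝ) := by
    rw [Real.rpow_neg hR0.le, one_div]
    norm_cast
  gcongr
  rw [← e2, ← e3]
  calc 64 * (C * (1 + 5 * R) ^ (3 / 2 : ℝ) + c) / R ^ 2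
      ≤ 64 * (C * (36 * R ^ (3 / 2 : ℝ)) + c) / R ^ 2 := by gcongr
    _ = _ := by ring

/-! ### Growth of Gamma factors and of completed `L`-functions. -/

-- `Λ₀` is an absolutely convergent Mellin integral for every `s`, and `t^(σ-1) ≤ t^(a-1) + t^(b-1)`
-- for `a ≤ σ ≤ b`; hence the bound is uniform on vertical strips.
open Complex MeasureTheory Set in
theorem WeakFEPair.exists_norm_Λ₀_le (P : WeakFEPair ℂ) (a b : ℝ) :
    ∃ B, ∀ s : ℂ, a ≤ s.re → s.re ≤ b → ‖P.Λ₀ s‖ ≤ B := by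
  have hconv : ∀ s : ℂ, IntegrableOn (fun t : ℝ => (t : ℂ) ^ (s - 1) • P.f_modif t) (Ioi 0) :=
    fun s => (P.isStrongFEPair_toStrongFEPair.hasMellin s).1
  have hnorm : ∀ (s : ℂ) (t : ℝ), t ∈ Ioi (0 : ℝ) →
      ‖(t : ℂ) ^ (s - 1) • P.f_modif t‖ = t ^ (s.re - 1) * ‖P.f_modif t‖ := by
    intro s t ht
    rw [norm_smul, norm_cpow_eq_rpow_re_of_pos ht]
    simp
  refine ⟨∫ t in Ioi (0 : ℝ), ‖(t : ℂ) ^ ((a : ℂ) - 1) • P.f_modif t‖ +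
    ‖(t : ℂ) ^ ((b : ℂ) - 1) • P.f_modif t‖, fun s hs1 hs2 => ?_⟩
  refine norm_integral_le_of_norm_le ((hconv a).norm.add (hconv b).norm) ?_
  refine (ae_restrict_iff' measurableSet_Ioi).2 (Filter.Eventually.of_forall fun t ht => ?_)
  have ht0 : (0 : ℝ) < t := ht
  simp only [hnorm _ t ht, ofReal_re]
  rw [← add_mul]
  gcongr
  rcases le_total 1 t with h1 | h1
  · have := Real.rpow_le_rpow_of_exponent_le h1 (by linarith : s.re - 1 ≤ b - 1)
    have := Real.rpow_nonneg ht0.le (a - 1)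
    linarith
  · have := Real.rpow_le_rpow_of_exponent_ge ht0 h1 (by linarith : a - 1 ≤ s.re - 1)
    have := Real.rpow_nonneg ht0.le (b - 1)
    linarith

open Complex MeasureTheory Set in
theorem Complex.norm_Gamma_le_Gamma_re {s : ℂ} (hs : 0 < s.re) : ‖Gamma s‖ ≤ Real.Gamma s.re := by
  rw [Gamma_eq_integral hs, GammaIntegral, Real.Gamma_eq_integral hs]
  refine (norm_integral_le_integral_norm _).trans (le_of_eq ?_)
  refine setIntegral_congr_fun measurableSet_Ioi fun x hx => ?_
  have hx0 : (0 : ℝ) < x := hx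
  simp only [norm_mul, norm_real, Real.norm_eq_abs, Real.abs_exp]
  rw [norm_cpow_eq_rpow_re_of_pos hx0]
  simp

/-- Through a factorial, `Γ(y) ≤ (1+y)^(1+y)`; then `log u ≤ 2 u^(1/2)` absorbs the logarithm. This
is where the exponent `3/2` arises. -/
theorem Real.Gamma_le_exp {y : ℝ} (hy : 1 ≤ y) :
    Real.Gamma y ≤ Real.exp (2 * (1 + y) ^ (3 / 2 : ℝ)) := by
  have hy0 : 0 < y := by linarith
  have h1 : Real.Gamma y ≤ Real.Gamma (y + 1) := by
    rw [Real.Gamma_add_one hy0.ne']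
    exact le_mul_of_one_le_left (Real.Gamma_pos_of_pos hy0).le hy
  have h2 : Real.Gamma (y + 1) ≤ (⌊y⌋₊ + 1).factorial := by
    rw [← Real.Gamma_nat_eq_factorial]
    have hlt := Nat.lt_floor_add_one y
    refine Real.Gamma_strictMonoOn_Ici.monotoneOn ?_ ?_ ?_
    · simp only [Set.mem_Ici]; linarith
    · simp only [Set.mem_Ici, Nat.cast_add, Nat.cast_one]; linarith
    · push_cast; linarith
  have h3 : ((⌊y⌋₊ + 1).factorial : ℝ) ≤ (1 + y) ^ (1 + y) := by
    have hfl := Nat.floor_le hy0.le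
    calc ((⌊y⌋₊ + 1).factorial : ℝ) ≤ ((⌊y⌋₊ + 1 : ℕ) : ℝ) ^ (⌊y⌋₊ + 1) := by
          exact_mod_cast Nat.factorial_le_pow _
      _ = ((⌊y⌋₊ + 1 : ℕ) : ℝ) ^ ((⌊y⌋₊ + 1 : ℕ) : ℝ) := (Real.rpow_natCast _ _).symm
      _ ≤ (1 + y) ^ ((⌊y⌋₊ + 1 : ℕ) : ℝ) := by
        gcongr
        push_cast; linarith
      _ ≤ (1 + y) ^ (1 + y) := by
        refine Real.rpow_le_rpow_of_exponent_le (by linarith) ?_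
        push_cast; linarith
  refine h1.trans (h2.trans (h3.trans ?_))
  have hy1 : 0 < 1 + y := by linarith
  rw [Real.rpow_def_of_pos hy1]
  refine Real.exp_le_exp.2 ?_
  have h4 := Real.log_le_rpow_div hy1.le (ε := 1 / 2) (by norm_num)
  have h5 : (1 + y) ^ (3 / 2 : ℝ) = (1 + y) ^ (1 / 2 : ℝ) * (1 + y) := by
    nth_rewrite 3 [← Real.rpow_one (1 + y)]
    rw [← Real.rpow_add hy1]
    norm_num
  rw [h5]
  have : Real.log (1 + y) * (1 + y) ≤ ((1 + y) ^ (1 / 2 : ℝ) / (1 / 2)) * (1 + y) := by gcongr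
  linarith

open Complex in
theorem Complex.norm_Gammaℝ_le {s : ℂ} (hs : 2 ≤ s.re) :
    ‖Gammaℝ s‖ ≤ Real.exp (2 * (1 + ‖s‖) ^ (3 / 2 : ℝ)) := by
  have hre : (s / 2).re = s.re / 2 := by simp
  rw [Gammaℝ_def, norm_mul, norm_cpow_eq_rpow_re_of_pos Real.pi_pos]
  have h1 : Real.pi ^ (-s / 2).re ≤ 1 := by
    refine Real.rpow_le_one_of_one_le_of_nonpos (by linarith [Real.pi_gt_three]) ?_
    simp
    linarith
  have h2 : ‖Gamma (s / 2)‖ ≤ Real.exp (2 * (1 + ‖s‖) ^ (3 / 2 : ℝ)) := by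
    refine (norm_Gamma_le_Gamma_re (by rw [hre]; linarith)).trans ?_
    refine (Real.Gamma_le_exp (by rw [hre]; linarith)).trans (Real.exp_le_exp.2 ?_)
    rw [hre]
    have := re_le_norm s
    gcongr
    linarith
  calc _ ≤ 1 * Real.exp (2 * (1 + ‖s‖) ^ (3 / 2 : ℝ)) := by gcongr
    _ = _ := one_mul _

open Complex in
theorem ZMod.exists_norm_LFunction_le {N : ℕ} [NeZero N] (Φ : ZMod N → ℂ) :
    ∃ B, ∀ s : ℂ, 2 ≤ s.re → ‖ZMod.LFunction Φ s‖ ≤ B := by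
  have hsum : Summable (LSeries.term (fun n : ℕ => Φ n) 2) :=
    ZMod.LSeriesSummable_of_one_lt_re Φ (by norm_num)
  refine ⟨∑' n, ‖LSeries.term (fun n : ℕ => Φ n) 2 n‖, fun s hs => ?_⟩
  rw [ZMod.LFunction_eq_LSeries Φ (by linarith)]
  exact tsum_of_norm_bounded hsum.norm.hasSum fun n =>
    LSeries.norm_term_le_of_re_le_re _ (by simpa using hs) n

-- In the expansion into Hurwitz zeta functions the polar parts at `0` and `1` carry the
-- coefficients `Φ 0` and `∑ j, Φ j`. Both vanish, so only the entire parts remain, and these are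
-- bounded on strips.
open Complex in
theorem ZMod.exists_norm_completedLFunction_le {N : ℕ} [NeZero N] {Φ : ZMod N → ℂ}
    (hΦ : Φ.Even) (h0 : Φ 0 = 0) (hsum : ∑ j, Φ j = 0) (a b : ℝ) :
    ∃ B, ∀ s : ℂ, a ≤ s.re → s.re ≤ b → ‖ZMod.completedLFunction Φ s‖ ≤ B := by
  choose B hB using fun j : ZMod N =>
    (HurwitzZeta.hurwitzEvenFEPair (ZMod.toAddCircle j)).exists_norm_Λ₀_le (a / 2) (b / 2)
  refine ⟨(N : ℝ) ^ (-a) * ∑ j, ‖Φ j‖ * (B j / 2), fun s hs1 hs2 => ?_⟩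
  have hN : (1 : ℝ) ≤ N := by exact_mod_cast NeZero.one_le
  have heq : ZMod.completedLFunction Φ s =
      N ^ (-s) * ∑ j, Φ j * HurwitzZeta.completedHurwitzZetaEven₀ (ZMod.toAddCircle j) s := by
    rw [ZMod.completedLFunction_def_even hΦ]
    simp only [HurwitzZeta.completedHurwitzZetaEven_eq, ZMod.toAddCircle_eq_zero,
      div_eq_mul_inv, ite_mul, one_mul, zero_mul, mul_sub, mul_ite, mul_zero,
      Finset.sum_sub_distrib, Fintype.sum_ite_eq', ← Finset.sum_mul, h0, hsum, sub_zero]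
  rw [heq, norm_mul]
  have hN0 : (0 : ℝ) < N := by linarith
  have h1 : ‖(N : ℂ) ^ (-s)‖ ≤ (N : ℝ) ^ (-a) := by
    rw [← ofReal_natCast, norm_cpow_eq_rpow_re_of_pos hN0]
    exact Real.rpow_le_rpow_of_exponent_le hN (by simpa using hs1)
  gcongr
  refine (norm_sum_le _ _).trans (Finset.sum_le_sum fun j _ => ?_)
  rw [norm_mul]
  gcongr
  rw [HurwitzZeta.completedHurwitzZetaEven₀, norm_div]
  have hre : (s / 2).re = s.re / 2 := by simp
  have := hB j (s / 2) (by rw [hre]; linarith) (by rw [hre]; linarith)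
  rw [norm_ofNat]
  linarith

/-! ### The centred completed `L`-function: evenness and order. -/

/-- The completed `L`-function, normalised to be even for a self-dual `Φ`. -/
noncomputable def centeredXi {N : ℕ} [NeZero N] (Φ : ZMod N → ℂ) (w : ℂ) : ℂ :=
  (N : ℂ) ^ (w / 2) * ZMod.completedLFunction Φ (1 / 2 + w)

section SelfDual

variable {N : ℕ} [NeZero N] {Φ : ZMod N → ℂ}

theorem sum_eq_zero_of_dft_eq (h0 : Φ 0 = 0) (hdft : ZMod.dft Φ = fun k => (√(N : ℝ) : ℂ) * Φ k) :
    ∑ j, Φ j = 0 := by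
  rw [← ZMod.dft_apply_zero, hdft]
  simp [h0]

theorem differentiable_centeredXi (h0 : Φ 0 = 0)
    (hdft : ZMod.dft Φ = fun k => (√(N : ℝ) : ℂ) * Φ k) : Differentiable ℂ (centeredXi Φ) := by
  have hd := ZMod.differentiable_completedLFunction h0 (sum_eq_zero_of_dft_eq h0 hdft)
  have hN : (N : ℂ) ≠ 0 := NeZero.ne _
  intro w
  unfold centeredXi
  have h1 : DifferentiableAt ℂ (fun w : ℂ => (N : ℂ) ^ (w / 2)) w :=
    DifferentiableAt.const_cpow (by fun_prop) (Or.inl hN)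
  exact h1.mul (hd.comp (by fun_prop : Differentiable ℂ fun w : ℂ => 1 / 2 + w) w)

open Complex in
theorem centeredXi_neg (hΦ : Φ.Even) (h0 : Φ 0 = 0)
    (hdft : ZMod.dft Φ = fun k => (√(N : ℝ) : ℂ) * Φ k) (w : ℂ) :
    centeredXi Φ (-w) = centeredXi Φ w := by
  have hN : (N : ℂ) ≠ 0 := NeZero.ne _
  have hFE := ZMod.completedLFunction_one_sub_even hΦ (1 / 2 + w)
    (Or.inr (sum_eq_zero_of_dft_eq h0 hdft)) (Or.inr h0)
  have hsqrt : (√(N : ℝ) : ℂ) = (N : ℂ) ^ (1 / 2 : ℂ) := by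
    rw [Real.sqrt_eq_rpow, ofReal_cpow (Nat.cast_nonneg N)]
    simp
  rw [hdft, ZMod.completedLFunction_const_mul, hsqrt] at hFE
  unfold centeredXi
  rw [show (1 : ℂ) / 2 + -w = 1 - (1 / 2 + w) by ring, hFE, ← mul_assoc, ← mul_assoc,
    ← cpow_add _ _ hN, ← cpow_add _ _ hN]
  congr 2
  ring

-- For `Re s ≤ 2` (with `s = 1/2 + w`, `Re w ≥ 0`) the strip bound applies, for `Re s ≥ 2` the
-- Dirichlet series is bounded and the Gamma factor is estimated, and `Re w < 0` follows by
-- evenness.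
open Complex in
theorem exists_norm_centeredXi_le (hΦ : Φ.Even) (h0 : Φ 0 = 0)
    (hdft : ZMod.dft Φ = fun k => (√(N : ℝ) : ℂ) * Φ k) :
    ∃ C : ℝ, 0 ≤ C ∧ ∀ w, ‖centeredXi Φ w‖ ≤ Real.exp (C * (1 + ‖w‖) ^ (3 / 2 : ℝ)) := by
  have hN : (1 : ℝ) ≤ N := by exact_mod_cast NeZero.one_le
  have hN0 : (0 : ℝ) < N := by linarith
  obtain ⟨B₁, hB₁⟩ := ZMod.exists_norm_completedLFunction_le hΦ h0
    (sum_eq_zero_of_dft_eq h0 hdft) (-1) 2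
  obtain ⟨B₂, hB₂⟩ := ZMod.exists_norm_LFunction_le Φ
  set C := Real.log N + |B₁| + |B₂| + 8
  have hlog : 0 ≤ Real.log N := Real.log_nonneg hN
  have hone : ∀ w : ℂ, (1 : ℝ) + ‖w‖ ≤ (1 + ‖w‖) ^ (3 / 2 : ℝ) := fun w =>
    Real.self_le_rpow_of_one_le (by linarith [norm_nonneg w]) (by norm_num)
  have hcpow : ∀ w : ℂ, ‖(N : ℂ) ^ (w / 2)‖ ≤ Real.exp (Real.log N * (1 + ‖w‖) ^ (3 / 2 : ℝ)) := by
    intro w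
    rw [← ofReal_natCast, norm_cpow_eq_rpow_re_of_pos hN0, Real.rpow_def_of_pos hN0]
    refine Real.exp_le_exp.2 (mul_le_mul_of_nonneg_left ?_ hlog)
    have h1 : (w / 2).re = w.re / 2 := by simp
    rw [h1]
    linarith [hone w, re_le_norm w, norm_nonneg w]
  have hconst : ∀ (B : ℝ) (w : ℂ), B ≤ Real.exp (|B| * (1 + ‖w‖) ^ (3 / 2 : ℝ)) := by
    intro B w
    have h1 : |B| * 1 ≤ |B| * (1 + ‖w‖) ^ (3 / 2 : ℝ) :=
      mul_le_mul_of_nonneg_left (by linarith [hone w, norm_nonneg w]) (abs_nonneg B)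
    linarith [le_abs_self B, Real.add_one_le_exp (|B| * (1 + ‖w‖) ^ (3 / 2 : ℝ))]
  have hright : ∀ w : ℂ, 0 ≤ w.re → ‖centeredXi Φ w‖ ≤
      Real.exp (C * (1 + ‖w‖) ^ (3 / 2 : ℝ)) := by
    intro w hw
    set X := (1 + ‖w‖) ^ (3 / 2 : ℝ) with hX
    have hX0 : 0 ≤ X := by positivity
    have hre : ((1 : ℂ) / 2 + w).re = 1 / 2 + w.re := by simp
    have hL : ‖ZMod.completedLFunction Φ (1 / 2 + w)‖ ≤ Real.exp ((|B₁| + |B₂| + 8) * X) := by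
      rcases le_total ((1 : ℂ) / 2 + w).re 2 with h | h
      · refine (hB₁ _ (by rw [hre]; linarith) h).trans ((hconst B₁ w).trans ?_)
        refine Real.exp_le_exp.2 (mul_le_mul_of_nonneg_right ?_ hX0)
        linarith [abs_nonneg B₂]
      · have hs0 : (1 : ℂ) / 2 + w ≠ 0 := by
          intro h'
          rw [h'] at h
          norm_num at h
        have hG : Gammaℝ (1 / 2 + w) ≠ 0 := Gammaℝ_ne_zero_of_re_pos (by linarith)
        have heq : ZMod.completedLFunction Φ (1 / 2 + w) =
            ZMod.LFunction Φ (1 / 2 + w) * Gammaℝ (1 / 2 + w) := by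
          rw [ZMod.LFunction_eq_completed_div_gammaFactor_even hΦ _ (Or.inl hs0),
            div_mul_cancel₀ _ hG]
        have hnorm : 1 + ‖(1 : ℂ) / 2 + w‖ ≤ 2 * (1 + ‖w‖) := by
          have h1 := norm_add_le ((1 : ℂ) / 2) w
          have h2 : ‖(1 : ℂ) / 2‖ = 1 / 2 := by norm_num
          linarith [norm_nonneg w]
        have hpow : (1 + ‖(1 : ℂ) / 2 + w‖) ^ (3 / 2 : ℝ) ≤ 4 * X := by
          calc (1 + ‖(1 : ℂ) / 2 + w‖) ^ (3 / 2 : ℝ) ≤ (2 * (1 + ‖w‖)) ^ (3 / 2 : ℝ) := by gcongr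
            _ = 2 ^ (3 / 2 : ℝ) * X := Real.mul_rpow (by norm_num) (by positivity)
            _ ≤ 2 ^ (2 : ℝ) * X := by
              gcongr
              · norm_num
              · norm_num
            _ = 4 * X := by norm_num
        rw [heq, norm_mul]
        calc ‖ZMod.LFunction Φ (1 / 2 + w)‖ * ‖Gammaℝ (1 / 2 + w)‖
            ≤ Real.exp (|B₂| * X) * Real.exp (8 * X) := by
              refine mul_le_mul ((hB₂ _ h).trans (hconst B₂ w)) ((norm_Gammaℝ_le h).trans ?_)
                (norm_nonneg _) (Real.exp_pos _).le
              exact Real.exp_le_exp.2 (by linarith)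
          _ = Real.exp ((|B₂| + 8) * X) := by rw [← Real.exp_add, add_mul]
          _ ≤ _ := by
            refine Real.exp_le_exp.2 (mul_le_mul_of_nonneg_right ?_ hX0)
            linarith [abs_nonneg B₁]
    rw [centeredXi, norm_mul]
    calc _ ≤ Real.exp (Real.log N * X) * Real.exp ((|B₁| + |B₂| + 8) * X) := by
          gcongr
          exact hcpow w
      _ = Real.exp (C * X) := by
        rw [← Real.exp_add]
        congr 1
        ring
  refine ⟨C, by positivity, fun w => ?_⟩
  rcases le_total 0 w.re with h | h
  · exact hright w h
  · rw [← centeredXi_neg hΦ h0 hdft, ← norm_neg w]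
    exact hright (-w) (by simpa using h)

end SelfDual

/-! ### Quadratic Gauss sums from theta functions. -/

open Complex Filter Topology in
theorem tendsto_jacobiTheta₂_one (x a : ℝ) :
    Tendsto (fun T : ℝ => jacobiTheta₂ x (a + T * I)) atTop (𝓝 1) := by
  have him : ∀ T : ℝ, ((a : ℂ) + T * I).im = T := fun T => by simp
  have hlim : ∀ n : ℤ, Tendsto (fun T : ℝ => jacobiTheta₂_term n x (a + T * I)) atTop
      (𝓝 (if n = 0 then 1 else 0)) := by
    intro n
    rcases eq_or_ne n 0 with rfl | hn
    · simp [jacobiTheta₂_term]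
    · rw [if_neg hn, tendsto_zero_iff_norm_tendsto_zero]
      simp only [norm_jacobiTheta₂_term, him, ofReal_im, mul_zero, sub_zero]
      have hpos : 0 < Real.pi * (n : ℝ) ^ 2 := by positivity
      have : Tendsto (fun T : ℝ => -(Real.pi * (n : ℝ) ^ 2 * T)) atTop atBot :=
        tendsto_neg_atTop_atBot.comp (tendsto_id.const_mul_atTop hpos)
      refine (Real.tendsto_exp_atBot.comp this).congr fun T => ?_
      simp only [Function.comp_apply]
      ring_nf
  have hsum := summable_pow_mul_jacobiTheta₂_term_bound 0 (T := 1) one_pos 0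
  have h := tendsto_tsum_of_dominated_convergence (f := fun (T : ℝ) (n : ℤ) =>
    jacobiTheta₂_term n x (a + T * I)) hsum hlim (by
      filter_upwards [eventually_ge_atTop 1] with T hT n
      have := norm_jacobiTheta₂_term_le one_pos (z := (x : ℂ)) (τ := a + T * I) (S := 0)
        (by simp) (by rw [him]; exact hT) n
      simpa using this)
  rw [tsum_ite_eq] at h
  exact h

open Complex in
theorem neg_I_mul_re (z : ℂ) : (-I * z).re = z.im := by simp

open Complex in
theorem cpow_neg_I_mul_neg_inv {ω : ℂ} (hω : 0 < ω.im) :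
    1 / (-I * (-1 / ω)) ^ (1 / 2 : ℂ) = (-I * ω) ^ (1 / 2 : ℂ) := by
  have h1 : -I * (-1 / ω) = (-I * ω)⁻¹ := by
    rw [mul_inv, inv_neg, inv_I, neg_neg]
    ring
  have h2 : (-I * ω).arg ≠ Real.pi := by
    intro h
    rw [arg_eq_pi_iff, neg_I_mul_re] at h
    linarith [h.1]
  rw [h1, inv_cpow _ _ h2, one_div, inv_inv]

open Complex in
theorem neg_inv_im_pos {ω : ℂ} (hω : 0 < ω.im) : 0 < (-1 / ω).im := by
  have h0 : ω ≠ 0 := by rintro rfl; simp at hω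
  rw [neg_div, neg_im, one_div, inv_im, ← neg_div, neg_neg]
  exact div_pos hω (normSq_pos.2 h0)

open Complex in
/-- The theta series over an arithmetic progression. -/
theorem hasSum_theta_progression {N : ℕ} (hN : N ≠ 0) (r : ℕ) {ω : ℂ} (hω : 0 < ω.im) :
    HasSum (fun m : ℤ => cexp (Real.pi * I * (m * N + r) ^ 2 * (-1 / (N ^ 2 * ω))))
      ((-I * ω) ^ (1 / 2 : ℂ) * jacobiTheta₂ (r / N) ω) := by
  have h0 : ω ≠ 0 := by rintro rfl; simp at hω
  have hN' : (N : ℂ) ≠ 0 := Nat.cast_ne_zero.2 hN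
  have hs := (hasSum_jacobiTheta₂_term (-(r / (N * ω))) (neg_inv_im_pos hω)).mul_left
    (cexp (Real.pi * I * r ^ 2 * (-1 / (N ^ 2 * ω))))
  rw [jacobiTheta₂_functional_equation, cpow_neg_I_mul_neg_inv hω] at hs
  convert! hs using 1
  · funext m
    rw [jacobiTheta₂_term, ← Complex.exp_add]
    congr 1
    field_simp
    ring
  · have e1 : -(r / (N * ω)) / (-1 / ω) = r / N := by field_simp
    have e2 : -1 / (-1 / ω) = ω := by field_simp
    rw [e1, e2]
    have e3 : cexp (Real.pi * I * r ^ 2 * (-1 / (N ^ 2 * ω))) *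
        cexp (-Real.pi * I * (-(r / (N * ω))) ^ 2 / (-1 / ω)) = 1 := by
      rw [← Complex.exp_add, Complex.exp_eq_one_iff]
      refine ⟨0, ?_⟩
      field_simp
      ring
    linear_combination (-((-I * ω) ^ (1 / 2 : ℂ) * jacobiTheta₂ (r / N) ω)) * e3

open Complex in
/-- A theta constant near a cusp, split into residue classes. -/
theorem jacobiTheta₂_zero_eq_sum {N : ℕ} [NeZero N] {τ ω : ℂ} (q : ℂ) (hω : 0 < ω.im)
    (hτ : 0 < τ.im) (hq : ∀ r : ℕ, ∀ m : ℤ, ∃ k : ℤ,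
      ((m * N + r) ^ 2 : ℂ) * q = r ^ 2 * q + 2 * k)
    (hτω : τ = q - 1 / (N ^ 2 * ω)) :
    jacobiTheta₂ 0 τ = (-I * ω) ^ (1 / 2 : ℂ) *
      ∑ r : Fin N, cexp (Real.pi * I * (r : ℕ) ^ 2 * q) * jacobiTheta₂ ((r : ℕ) / N) ω := by
  have h1 := hasSum_jacobiTheta₂_term 0 hτ
  rw [← (Int.divModEquiv N).symm.hasSum_iff] at h1
  have h2 : HasSum (fun p : Fin N × ℤ => jacobiTheta₂_term (p.2 * N + (p.1 : ℕ)) 0 τ)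
      (jacobiTheta₂ 0 τ) := by
    rw [← (Equiv.prodComm ℤ (Fin N)).hasSum_iff]
    exact h1
  have h3 : ∀ r : Fin N, HasSum (fun m : ℤ => jacobiTheta₂_term (m * N + (r : ℕ)) 0 τ)
      (cexp (Real.pi * I * (r : ℕ) ^ 2 * q) *
        ((-I * ω) ^ (1 / 2 : ℂ) * jacobiTheta₂ ((r : ℕ) / N) ω)) := by
    intro r
    convert! (hasSum_theta_progression (NeZero.ne N) r hω).mul_left
      (cexp (Real.pi * I * (r : ℕ) ^ 2 * q)) using 1
    funext m
    -- Modulo `2`, `n² q` depends only on the class `r` of `n` modulo `N`, so the phase `exp(πi n²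
    -- q)` is constant along each progression.
    obtain ⟨k, hk⟩ := hq r m
    rw [jacobiTheta₂_term, ← Complex.exp_add, Complex.exp_eq_exp_iff_exists_int]
    refine ⟨k, ?_⟩
    rw [hτω]
    push_cast
    linear_combination (Real.pi * I) * hk
  have h4 := (h2.prod_fiberwise h3).unique (hasSum_fintype _)
  rw [h4, Finset.mul_sum]
  exact Finset.sum_congr rfl fun r _ => by ring

open Complex in
theorem ofReal_mul_cpow {t : ℝ} (ht : 0 < t) {z : ℂ} (hz : z ≠ 0) (s : ℂ) :
    ((t : ℂ) * z) ^ s = (t : ℂ) ^ s * z ^ s := by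
  have ht' : (t : ℂ) ≠ 0 := ofReal_ne_zero.2 ht.ne'
  rw [cpow_def_of_ne_zero (mul_ne_zero ht' hz), cpow_def_of_ne_zero ht', cpow_def_of_ne_zero hz,
    ← Complex.exp_add, log_ofReal_mul ht hz, ofReal_log ht.le]
  ring_nf

open Complex Filter Topology in
/-- Evaluation of the quadratic Gauss sum, by comparing a theta constant at two cusps. -/
theorem sum_exp_sq_eq (N : ℕ) [NeZero N] :
    ∑ r : Fin N, cexp (Real.pi * I * (r : ℕ) ^ 2 * (2 / N)) =
      (N / 2 * I) ^ (1 / 2 : ℂ) * (1 + cexp (-(Real.pi * I * (N / 2)))) := by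
  have hN : (N : ℂ) ≠ 0 := NeZero.ne _
  have hN0 : (0 : ℝ) < N := by exact_mod_cast NeZero.pos N
  -- The theta inversion relates `θ(-1/σ)` to `θ(σ)` for `σ = -N/2 + i/(4T)`. As `T → ∞`, `σ` tends
  -- to the cusp `-N/2` and `-1/σ` to the cusp `2/N`. Expanding by residue classes at both cusps and
  -- cancelling `T^(1/2)` gives this identity, in whose limit every theta value is `1`.
  have hid : ∀ T : ℝ, 0 < T →
      (1 + (1 / T : ℝ) * (-I / (2 * N))) ^ (1 / 2 : ℂ) *
        ∑ r : Fin N, cexp (Real.pi * I * (r : ℕ) ^ 2 * (2 / N)) *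
          jacobiTheta₂ ((r : ℕ) / N) (1 / (2 * N) + T * I) =
      ((1 / T : ℝ) * (1 / 4) + N / 2 * I) ^ (1 / 2 : ℂ) *
        ∑ r : Fin 2, cexp (Real.pi * I * (r : ℕ) ^ 2 * (-(N / 2))) *
          jacobiTheta₂ ((r : ℕ) / (2 : ℕ)) (T * I) := by
    intro T hT
    have hT' : (T : ℂ) ≠ 0 := ofReal_ne_zero.2 hT.ne'
    set σ : ℂ := -(N / 2) - 1 / ((2 : ℕ) ^ 2 * (T * I)) with hσ
    set ω : ℂ := 1 / (2 * N) + T * I with hω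
    have hTI : 0 < ((T : ℂ) * I).im := by simpa using hT
    have hσ' : -I * σ = (1 / T : ℝ) * (1 / 4) + N / 2 * I := by
      rw [hσ]
      push_cast
      field_simp
      ring
    have hω' : -I * ω = T * (1 + (1 / T : ℝ) * (-I / (2 * N))) := by
      rw [hω]
      push_cast
      field_simp
      linear_combination (-2 * (N : ℂ) * T) * I_sq
    have hσim : 0 < σ.im := by
      rw [← neg_I_mul_re, hσ']
      simp
      positivity
    have hωim : 0 < ω.im := by
      have : ω.im = T := by
        rw [hω, show (1 : ℂ) / (2 * N) = ((1 / (2 * N) : ℝ) : ℂ) by push_cast; rfl]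
        simp
      rwa [this]
    have hσ0 : σ ≠ 0 := by rintro h; rw [h] at hσim; simp at hσim
    have hω0 : ω ≠ 0 := by rintro h; rw [h] at hωim; simp at hωim
    have hτ := neg_inv_im_pos hσim
    have hcusp : -1 / σ = 2 / N - 1 / ((N : ℂ) ^ 2 * ω) := by
      have hσω : σ * (2 * N * ω - 1) = -(N ^ 2 * ω) := by
        rw [hσ, hω]
        push_cast
        field_simp
        ring
      have : 2 / N - 1 / ((N : ℂ) ^ 2 * ω) = (2 * N * ω - 1) / (N ^ 2 * ω) := by
        field_simp
      rw [this, div_eq_div_iff hσ0 (mul_ne_zero (pow_ne_zero 2 hN) hω0)]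
      linear_combination -hσω
    have e1 := jacobiTheta₂_zero_eq_sum (N := N) (q := 2 / N) hωim hτ (fun r m =>
      ⟨m ^ 2 * N + 2 * m * r, by push_cast; field_simp; ring⟩) hcusp
    have e2 := jacobiTheta₂_zero_eq_sum (N := 2) (q := -(N / 2 : ℂ)) hTI hσim (fun r m =>
      ⟨-(m ^ 2 * N + m * r * N), by push_cast; ring⟩) hσ
    have e3 := jacobiTheta₂_functional_equation 0 (-1 / σ)
    rw [cpow_neg_I_mul_neg_inv hσim, zero_div, show -1 / (-1 / σ) = σ by field_simp] at e3
    simp only [ne_eq, OfNat.ofNat_ne_zero, not_false_eq_true, zero_pow, mul_zero, zero_div,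
      Complex.exp_zero, mul_one] at e3
    rw [e1, e2, hσ', hω', ofReal_mul_cpow hT] at e3
    · have hTT : -I * (T * I) = T := by linear_combination (-(T : ℂ)) * I_sq
      rw [hTT] at e3
      have hc : (T : ℂ) ^ (1 / 2 : ℂ) ≠ 0 := by simp [hT']
      refine mul_left_cancel₀ hc ?_
      rw [← mul_assoc, e3]
      ring
    · intro h
      have := congrArg re h
      rw [show -I / (2 * (N : ℂ)) = ((1 / (2 * N) : ℝ) : ℂ) * (-I) by push_cast; ring] at this
      simp at this
  have hinv : Tendsto (fun T : ℝ => ((1 / T : ℝ) : ℂ)) atTop (𝓝 0) := by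
    have := tendsto_inv_atTop_zero (𝕜 := ℝ)
    simp only [one_div]
    exact_mod_cast (continuous_ofReal.tendsto 0).comp this
  have htheta : ∀ x a : ℝ, Tendsto (fun T : ℝ => jacobiTheta₂ x (a + T * I)) atTop (𝓝 1) :=
    tendsto_jacobiTheta₂_one
  have hlim1 : Tendsto (fun T : ℝ => (1 + ((1 / T : ℝ) : ℂ) * (-I / (2 * N))) ^ (1 / 2 : ℂ) *
        ∑ r : Fin N, cexp (Real.pi * I * (r : ℕ) ^ 2 * (2 / N)) *
          jacobiTheta₂ ((r : ℕ) / N) (1 / (2 * N) + T * I)) atTop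
      (𝓝 (1 * ∑ r : Fin N, cexp (Real.pi * I * (r : ℕ) ^ 2 * (2 / N)) * 1)) := by
    refine Tendsto.mul ?_ (tendsto_finsetSum _ fun r _ => Tendsto.const_mul _ ?_)
    · have h1 : Tendsto (fun T : ℝ => 1 + ((1 / T : ℝ) : ℂ) * (-I / (2 * N))) atTop (𝓝 1) := by
        simpa using (hinv.mul_const (-I / (2 * (N : ℂ)))).const_add 1
      have h2 := (continuousAt_cpow_const (a := 1) (b := 1 / 2) one_mem_slitPlane).tendsto.comp h1
      rwa [one_cpow] at h2
    · have := htheta ((r : ℕ) / N) (1 / (2 * N))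
      push_cast at this
      exact this
  have hslit : (N / 2 * I : ℂ) ∈ slitPlane := by
    right
    simp
    exact NeZero.ne N
  have hlim2 : Tendsto (fun T : ℝ => (((1 / T : ℝ) : ℂ) * (1 / 4) + N / 2 * I) ^ (1 / 2 : ℂ) *
        ∑ r : Fin 2, cexp (Real.pi * I * (r : ℕ) ^ 2 * (-(N / 2))) *
          jacobiTheta₂ ((r : ℕ) / (2 : ℕ)) (T * I)) atTop
      (𝓝 ((N / 2 * I) ^ (1 / 2 : ℂ) *
        ∑ r : Fin 2, cexp (Real.pi * I * (r : ℕ) ^ 2 * (-(N / 2))) * 1)) := by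
    refine Tendsto.mul ?_ (tendsto_finsetSum _ fun r _ => Tendsto.const_mul _ ?_)
    · have h1 : Tendsto (fun T : ℝ => ((1 / T : ℝ) : ℂ) * (1 / 4) + N / 2 * I) atTop
          (𝓝 (N / 2 * I)) := by
        simpa using (hinv.mul_const (1 / 4 : ℂ)).add_const (N / 2 * I : ℂ)
      exact (continuousAt_cpow_const hslit).tendsto.comp h1
    · have := htheta ((r : ℕ) / (2 : ℕ)) 0
      push_cast at this ⊢
      simpa using this
  have hlim2' := hlim2.congr' (by
    filter_upwards [eventually_gt_atTop 0] with T hT using (hid T hT).symm)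
  have := tendsto_nhds_unique hlim1 hlim2'
  simp only [mul_one, one_mul] at this
  rw [this, Fin.sum_univ_two]
  simp

open Complex in
theorem cpow_half_mul_I {t : ℝ} (ht : 0 < t) :
    ((t : ℂ) / 2 * I) ^ (1 / 2 : ℂ) = (√t : ℂ) * ((1 + I) / 2) := by
  have h : (t : ℂ) / 2 * I = ((√t : ℂ) * ((1 + I) / 2)) ^ 2 := by
    have : (√t : ℂ) ^ 2 = t := by
      rw [← ofReal_pow, Real.sq_sqrt ht.le]
    rw [mul_pow, this]
    linear_combination (-(t : ℂ) / 4) * I_sq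
  rw [h, one_div, sq_cpow_two_inv]
  rw [show (1 + I) / 2 = ((1 / 2 : ℝ) : ℂ) + (1 / 2 : ℝ) * I by push_cast; ring]
  simp
  positivity

open Complex in
theorem exp_neg_pi_mul_I_mul_half (N : ℕ) :
    cexp (-(Real.pi * I * (N / 2))) = (-I) ^ N := by
  rw [show -(Real.pi * I * (N / 2) : ℂ) = N * (-(Real.pi / 2 * I)) by ring, Complex.exp_nat_mul,
    Complex.exp_neg, exp_pi_div_two_mul_I, inv_I]

/-- The sign of the quadratic Gauss sum modulo an odd number. -/
noncomputable def gaussEpsilon (N : ℕ) : ℂ := if N % 4 = 1 then 1 else Complex.I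

open Complex in
theorem sum_exp_sq_of_odd {N : ℕ} [NeZero N] (hN : Odd N) :
    ∑ r : Fin N, cexp (Real.pi * I * (r : ℕ) ^ 2 * (2 / N)) = gaussEpsilon N * (√(N : ℝ) : ℂ) := by
  have hN0 : (0 : ℝ) < N := by exact_mod_cast NeZero.pos N
  have h1 := cpow_half_mul_I hN0
  rw [ofReal_natCast] at h1
  rw [sum_exp_sq_eq, h1, exp_neg_pi_mul_I_mul_half]
  have hpow4 : (-I) ^ 4 = 1 := by
    rw [neg_pow, I_pow_four]; norm_num
  have hpow : (-I) ^ N = (-I) ^ (N % 4) := by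
    conv_lhs => rw [← Nat.div_add_mod N 4, pow_add, pow_mul, hpow4, one_pow, one_mul]
  rcases (by have := Nat.odd_iff.1 hN; omega : N % 4 = 1 ∨ N % 4 = 3) with h | h
  · rw [hpow, gaussEpsilon, if_pos h, h, pow_one]
    linear_combination (-(√(N : ℝ) : ℂ) / 2) * I_sq
  · rw [hpow, gaussEpsilon, if_neg (by omega), h]
    linear_combination (-(√(N : ℝ) : ℂ) / 2 * (I ^ 2 + I - 1)) * I_sq

/-! ### Self-dual characters and the root number of `χ_d`. -/

/-- A completely multiplicative function on residue classes modulo `N` that is an eigenvector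
of the discrete Fourier transform. -/
structure IsSelfDual (N : ℕ) [NeZero N] (f : ℕ → ℤ) (c : ℂ) : Prop where
  periodic : ∀ n, f (n % N) = f n
  map_mul : ∀ m n, f (m * n) = f m * f n
  sum_eq : ∀ k : ℕ, ∑ j : ZMod N, ZMod.stdAddChar (j * (k : ZMod N)) * (f j.val : ℂ) = c * f k

theorem ZMod.sum_eq_sum_fin {N : ℕ} [NeZero N] (F : ZMod N → ℂ) :
    ∑ j : ZMod N, F j = ∑ r : Fin N, F ((r : ℕ) : ZMod N) := by
  refine (Function.Bijective.sum_comp ?_ F).symm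
  rw [Fintype.bijective_iff_injective_and_card]
  refine ⟨fun r s h => ?_, by simp [ZMod.card]⟩
  have h' := (ZMod.natCast_eq_natCast_iff' _ _ _).1 h
  rw [Nat.mod_eq_of_lt r.2, Nat.mod_eq_of_lt s.2] at h'
  exact Fin.ext h'

theorem ZMod.sum_eq_sum_prod {M N : ℕ} [NeZero M] [NeZero N] (h : M.Coprime N)
    (F : ZMod (M * N) → ℂ) :
    ∑ j : ZMod (M * N), F j =
      ∑ p : ZMod M × ZMod N, F ((p.1.val * N + p.2.val * M : ℕ) : ZMod (M * N)) := by
  refine (Function.Bijective.sum_comp ?_ F).symm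
  rw [Fintype.bijective_iff_injective_and_card]
  refine ⟨fun p q hpq => ?_, by simp [ZMod.card]⟩
  have h' := (ZMod.natCast_eq_natCast_iff _ _ _).1 hpq
  have hM := h'.of_mul_right N
  have hN := h'.of_mul_left M
  have e1 : p.1.val * N ≡ q.1.val * N [MOD M] := by
    simpa [Nat.ModEq, Nat.add_mul_mod_self_right] using hM
  have e2 : p.2.val * M ≡ q.2.val * M [MOD N] := by
    simpa [Nat.ModEq, Nat.mul_add_mod_self_right] using hN
  have e1' := Nat.ModEq.cancel_right_of_coprime h e1
  have e2' := Nat.ModEq.cancel_right_of_coprime h.symm e2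
  refine Prod.ext (ZMod.val_injective M ?_) (ZMod.val_injective N ?_)
  · exact e1'.eq_of_lt_of_lt (ZMod.val_lt _) (ZMod.val_lt _)
  · exact e2'.eq_of_lt_of_lt (ZMod.val_lt _) (ZMod.val_lt _)

theorem IsSelfDual.apply_eq {N : ℕ} [NeZero N] {f : ℕ → ℤ} {c : ℂ} (hf : IsSelfDual N f c)
    {m n : ℕ} (h : m ≡ n [MOD N]) : f m = f n := by
  rw [← hf.periodic m, ← hf.periodic n, h]

-- Write `j = xN + yM` by the Chinese remainder theorem. The additive character splits into those
-- modulo `M` and `N`, while `f(j) = f(x) f(N)` and `g(j) = g(y) g(M)`; the cross values enter the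
-- eigenvalue.
open Complex in
theorem IsSelfDual.mul {M N : ℕ} [NeZero M] [NeZero N] (h : M.Coprime N) {f g : ℕ → ℤ} {a b : ℂ}
    (hf : IsSelfDual M f a) (hg : IsSelfDual N g b) :
    IsSelfDual (M * N) (fun n => f n * g n) (a * b * f N * g M) := by
  have hf' : ∀ n, f (n % (M * N)) = f n := fun n =>
    hf.apply_eq ((Nat.mod_modEq n (M * N)).of_mul_right N)
  have hg' : ∀ n, g (n % (M * N)) = g n := fun n =>
    hg.apply_eq ((Nat.mod_modEq n (M * N)).of_mul_left M)
  refine ⟨fun n => by rw [hf', hg'], fun m n => by rw [hf.map_mul, hg.map_mul]; ring, fun k => ?_⟩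
  have hM : (M : ℂ) ≠ 0 := NeZero.ne _
  have hN : (N : ℂ) ≠ 0 := NeZero.ne _
  have hterm : ∀ p : ZMod M × ZMod N,
      ZMod.stdAddChar (((p.1.val * N + p.2.val * M : ℕ) : ZMod (M * N)) * (k : ZMod (M * N))) *
        (((f ((p.1.val * N + p.2.val * M : ℕ) : ZMod (M * N)).val) *
          (g ((p.1.val * N + p.2.val * M : ℕ) : ZMod (M * N)).val) : ℤ) : ℂ) =
      (f N * g M) * ((ZMod.stdAddChar (p.1 * (k : ZMod M)) * (f p.1.val : ℂ)) *
        (ZMod.stdAddChar (p.2 * (k : ZMod N)) * (g p.2.val : ℂ))) := by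
    rintro ⟨x, y⟩
    have e1 : f ((x.val * N + y.val * M : ℕ) : ZMod (M * N)).val = f x.val * f N := by
      rw [ZMod.val_natCast, hf', ← hf.map_mul]
      exact hf.apply_eq (by simp [Nat.ModEq])
    have e2 : g ((x.val * N + y.val * M : ℕ) : ZMod (M * N)).val = g y.val * g M := by
      rw [ZMod.val_natCast, hg', ← hg.map_mul]
      exact hg.apply_eq (by simp [Nat.ModEq])
    have e3 : ZMod.stdAddChar
        (((x.val * N + y.val * M : ℕ) : ZMod (M * N)) * (k : ZMod (M * N))) =
        ZMod.stdAddChar (x * (k : ZMod M)) * ZMod.stdAddChar (y * (k : ZMod N)) := by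
      have h1 : x * (k : ZMod M) = ((x.val * k : ℤ) : ZMod M) := by
        push_cast [ZMod.natCast_zmod_val]; rfl
      have h2 : y * (k : ZMod N) = ((y.val * k : ℤ) : ZMod N) := by
        push_cast [ZMod.natCast_zmod_val]; rfl
      have h3 : ((x.val * N + y.val * M : ℕ) : ZMod (M * N)) * (k : ZMod (M * N)) =
          (((x.val * N + y.val * M) * k : ℤ) : ZMod (M * N)) := by
        push_cast; rfl
      rw [h1, h2, h3, ZMod.stdAddChar_coe, ZMod.stdAddChar_coe, ZMod.stdAddChar_coe,
        ← Complex.exp_add]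
      congr 1
      push_cast
      field_simp
    simp only [e1, e2, e3]
    push_cast
    ring
  rw [ZMod.sum_eq_sum_prod h]
  simp only [hterm]
  rw [← Finset.mul_sum, Fintype.sum_prod_type]
  simp only [← Finset.mul_sum, ← Finset.sum_mul]
  rw [hf.sum_eq, hg.sum_eq]
  push_cast
  ring

-- A residue `j` has `1 + (j/p)` square roots and the additive character sums to `0`, so the Gauss
-- sum of the Legendre symbol equals `∑ exp(2πi r²/p)`, which is already evaluated. Shifting by a
-- unit `k` multiplies it by `(k/p)`.
open Complex in
theorem isSelfDual_jacobiSym_prime {p : ℕ} [Fact p.Prime] (hp : p ≠ 2) :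
    IsSelfDual p (fun n => J(n | p)) (gaussEpsilon p * (√(p : ℝ) : ℂ)) := by
  have hval : ∀ j : ZMod p, J((j.val : ℤ) | p) = quadraticChar (ZMod p) j := by
    intro j
    rw [← jacobiSym.legendreSym.to_jacobiSym, legendreSym]
    simp
  have hnat : ∀ k : ℕ, J((k : ℤ) | p) = quadraticChar (ZMod p) k := by
    intro k
    rw [← jacobiSym.legendreSym.to_jacobiSym, legendreSym]
    simp
  have hchar : ringChar (ZMod p) ≠ 2 := by rwa [ZMod.ringChar_zmod_n]
  have hodd : Odd p := (Fact.out : p.Prime).odd_of_ne_two hp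
  set χ : MulChar (ZMod p) ℂ := (quadraticChar (ZMod p)).ringHomComp (Int.castRingHom ℂ) with hχ
  have hχapp : ∀ j, χ j = (quadraticChar (ZMod p) j : ℂ) := fun j => rfl
  have hψ := ZMod.isPrimitive_stdAddChar p
  have hψ0 : ∑ j : ZMod p, ZMod.stdAddChar j = 0 :=
    AddChar.sum_eq_zero_of_ne_one (by simpa using hψ one_ne_zero)
  have hG : gaussSum χ ZMod.stdAddChar = gaussEpsilon p * (√(p : ℝ) : ℂ) := by
    have h1 : gaussSum χ ZMod.stdAddChar =
        ∑ j : ZMod p, ((quadraticChar (ZMod p) j + 1 : ℤ) : ℂ) * ZMod.stdAddChar j := by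
      rw [gaussSum, ← add_zero (∑ j : ZMod p, _), ← hψ0, ← Finset.sum_add_distrib]
      refine Finset.sum_congr rfl fun j _ => ?_
      rw [hχapp]
      push_cast
      ring
    have h2 : ∑ x : ZMod p, ZMod.stdAddChar (x ^ 2) =
        ∑ j : ZMod p, ((quadraticChar (ZMod p) j + 1 : ℤ) : ℂ) * ZMod.stdAddChar j := by
      rw [← Finset.sum_fiberwise (Finset.univ : Finset (ZMod p)) (fun x : ZMod p => x ^ 2)]
      refine Finset.sum_congr rfl fun j _ => ?_
      rw [← quadraticChar_card_sqrts hchar j, Finset.sum_congr rfl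
        (g := fun _ => ZMod.stdAddChar j) (fun x hx => by rw [(Finset.mem_filter.1 hx).2]),
        Finset.sum_const, nsmul_eq_mul]
      congr 2
      congr 1
      ext x
      simp
    rw [h1, ← h2, ZMod.sum_eq_sum_fin, ← sum_exp_sq_of_odd hodd]
    refine Finset.sum_congr rfl fun r _ => ?_
    have h3 : ((r : ℕ) : ZMod p) ^ 2 = (((r : ℕ) ^ 2 : ℤ) : ZMod p) := by push_cast; rfl
    rw [h3, ZMod.stdAddChar_coe]
    congr 1
    push_cast
    ring
  refine ⟨fun n => ?_, fun m n => ?_, fun k => ?_⟩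
  · simp only [hnat, ZMod.natCast_mod]
  · rw [Nat.cast_mul, jacobiSym.mul_left]
  · simp only [hval, hnat]
    rcases eq_or_ne (k : ZMod p) 0 with hk | hk
    · have h0 : ∑ j : ZMod p, (quadraticChar (ZMod p) j : ℂ) = 0 := by
        exact_mod_cast congrArg (Int.cast (R := ℂ)) (quadraticChar_sum_zero hchar)
      simp only [hk, mul_zero, AddChar.map_zero_eq_one, one_mul, h0]
      simp
    · have h1 := gaussSum_mulShift χ ZMod.stdAddChar (Units.mk0 (k : ZMod p) hk)
      rw [hG, Units.val_mk0, hχapp, gaussSum] at h1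
      have hsq : (quadraticChar (ZMod p) (k : ZMod p) : ℂ) ^ 2 = 1 := by
        exact_mod_cast quadraticChar_sq_one hk
      have h2 : ∑ j : ZMod p, ZMod.stdAddChar (j * (k : ZMod p)) *
          (quadraticChar (ZMod p) j : ℂ) =
          ∑ j : ZMod p, χ j * (AddChar.mulShift ZMod.stdAddChar (k : ZMod p)) j := by
        refine Finset.sum_congr rfl fun j _ => ?_
        rw [AddChar.mulShift_apply, hχapp, mul_comm j, mul_comm]
      rw [h2, ← h1]
      linear_combination (-(∑ j : ZMod p, χ j *
        (AddChar.mulShift ZMod.stdAddChar (k : ZMod p)) j)) * hsq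

/-- Quadratic reciprocity: when `a ≡ b ≡ 3 (mod 4)` the sign of the cross symbols cancels `i² = -1`.
This is the compatibility that lets Gauss sums be glued over coprime moduli. -/
theorem gaussEpsilon_mul {a b : ℕ} (ha : Odd a) (hb : Odd b) (hab : a.Coprime b) :
    gaussEpsilon a * gaussEpsilon b * J(b | a) * J(a | b) = gaussEpsilon (a * b) := by
  have hsq : ((J(b | a) : ℤ) : ℂ) * J(b | a) = 1 := by
    have := jacobiSym.sq_one (a := (b : ℤ)) (b := a)
      (by rw [Int.gcd_natCast_natCast]; exact hab.symm)
    rw [← pow_two]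
    exact_mod_cast this
  have hmod : ∀ {n : ℕ}, Odd n → n % 4 = 1 ∨ n % 4 = 3 := fun hn => by
    have := Nat.odd_iff.1 hn; omega
  have hmul := Nat.mul_mod a b 4
  rcases hmod ha with h1 | h1
  · rw [jacobiSym.quadratic_reciprocity_one_mod_four h1 hb, mul_assoc, hsq]
    rw [h1, one_mul, Nat.mod_mod] at hmul
    simp [gaussEpsilon, h1, hmul]
  · rcases hmod hb with h2 | h2
    · rw [jacobiSym.quadratic_reciprocity_one_mod_four' ha h2, mul_assoc, hsq]
      rw [h2, mul_one, Nat.mod_mod] at hmul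
      simp [gaussEpsilon, h2, hmul]
    · rw [jacobiSym.quadratic_reciprocity_three_mod_four h1 h2]
      push_cast
      rw [mul_neg, mul_assoc, hsq]
      rw [h1, h2] at hmul
      simp [gaussEpsilon, h1, h2, hmul]

theorem isSelfDual_jacobiSym (n : ℕ) [NeZero n] (hodd : Odd n) (hsq : Squarefree n) :
    IsSelfDual n (fun k => J(k | n)) (gaussEpsilon n * (√(n : ℝ) : ℂ)) := by
  rename_i inst
  revert inst
  induction n using induction_on_primes with
  | zero => simp at hodd
  | one =>
    intro _
    refine ⟨fun k => by simp, fun k l => by simp, fun k => ?_⟩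
    rw [ZMod.sum_eq_sum_fin]
    simp [gaussEpsilon]
  | prime_mul p m hp ih =>
    intro _
    obtain ⟨hcop, -, hm⟩ := Nat.squarefree_mul_iff.1 hsq
    obtain ⟨ho1, ho2⟩ := Nat.odd_mul.1 hodd
    have : NeZero m := ⟨by rintro rfl; simp at ho2⟩
    have : Fact p.Prime := ⟨hp⟩
    have hp2 : p ≠ 2 := by rintro rfl; exact absurd ho1 (by decide)
    have h := (isSelfDual_jacobiSym_prime hp2).mul hcop (ih ho2 hm)
    have hf : (fun k : ℕ => J(k | p * m)) = fun k : ℕ => J(k | p) * J(k | m) := by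
      funext k
      rw [jacobiSym.mul_right]
    have hc : gaussEpsilon (p * m) * (√((p * m : ℕ) : ℝ) : ℂ) =
        gaussEpsilon p * (√(p : ℝ) : ℂ) * (gaussEpsilon m * (√(m : ℝ) : ℂ)) *
          J(m | p) * J(p | m) := by
      rw [← gaussEpsilon_mul ho1 ho2 hcop, Nat.cast_mul, Real.sqrt_mul (Nat.cast_nonneg p)]
      push_cast
      ring
    rw [hf, hc]
    exact h

theorem isSelfDual_of_mulChar {N : ℕ} [NeZero N] (χ : MulChar (ZMod N) ℤ) {c : ℂ}
    (h : ∀ k : ZMod N, ∑ j : ZMod N, ZMod.stdAddChar (j * k) * (χ j : ℂ) = c * χ k) :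
    IsSelfDual N (fun n => χ (n : ZMod N)) c := by
  refine ⟨fun n => by simp, fun m n => by simp, fun k => ?_⟩
  simp only [ZMod.natCast_zmod_val]
  exact h k

open Complex in
theorem stdAddChar_four (x : Fin 4) :
    (ZMod.stdAddChar : AddChar (ZMod 4) ℂ) x = (![1, I, -1, -I] : Fin 4 → ℂ) x := by
  have h1 : (ZMod.stdAddChar : AddChar (ZMod 4) ℂ) 1 = I := by
    have := ZMod.stdAddChar_coe (N := 4) 1
    rw [Int.cast_one] at this
    rw [this]
    refine (congrArg cexp ?_).trans exp_pi_div_two_mul_I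
    push_cast
    ring
  have h : ∀ n : ℕ, (ZMod.stdAddChar : AddChar (ZMod 4) ℂ) (n : ZMod 4) = I ^ n := fun n => by
    rw [← h1, ← AddChar.map_nsmul_eq_pow, nsmul_one]
  have hx : (x : ZMod 4) = ((x.val : ℕ) : ZMod 4) := (ZMod.natCast_zmod_val (n := 4) x).symm
  rw [hx, h]
  fin_cases x <;> simp [I_pow_three]

open Complex in
theorem stdAddChar_eight (x : Fin 8) :
    (ZMod.stdAddChar : AddChar (ZMod 8) ℂ) x =
      (![1, (√2 : ℂ) / 2 * (1 + I), I, (√2 : ℂ) / 2 * (-1 + I), -1, -((√2 : ℂ) / 2 * (1 + I)), -I,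
        -((√2 : ℂ) / 2 * (-1 + I))] : Fin 8 → ℂ) x := by
  have h1 : (ZMod.stdAddChar : AddChar (ZMod 8) ℂ) 1 = (√2 : ℂ) / 2 * (1 + I) := by
    have := ZMod.stdAddChar_coe (N := 8) 1
    rw [Int.cast_one] at this
    rw [this, show (2 * Real.pi * I * (1 : ℤ) / (8 : ℕ) : ℂ) = ((Real.pi / 4 : ℝ) : ℂ) * I by
      push_cast; ring, exp_mul_I, ← ofReal_cos, ← ofReal_sin, Real.cos_pi_div_four,
      Real.sin_pi_div_four]
    push_cast
    ring
  have h : ∀ n : ℕ, (ZMod.stdAddChar : AddChar (ZMod 8) ℂ) (n : ZMod 8) =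
      ((√2 : ℂ) / 2 * (1 + I)) ^ n := fun n => by
    rw [← h1, ← AddChar.map_nsmul_eq_pow, nsmul_one]
  have h2 : ((√2 : ℂ)) ^ 2 = 2 := by
    rw [← ofReal_pow, Real.sq_sqrt (by norm_num)]
    norm_num
  have p2 : ((√2 : ℂ) / 2 * (1 + I)) ^ 2 = I := by
    rw [mul_pow, div_pow, h2]
    linear_combination (1 / 2 : ℂ) * I_sq
  have p3 : ((√2 : ℂ) / 2 * (1 + I)) ^ 3 = (√2 : ℂ) / 2 * (-1 + I) := by
    rw [pow_succ, p2]
    linear_combination ((√2 : ℂ) / 2) * I_sq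
  have p4 : ((√2 : ℂ) / 2 * (1 + I)) ^ 4 = -1 := by
    rw [show 4 = 2 * 2 from rfl, pow_mul, p2, I_sq]
  have hx : (x : ZMod 8) = ((x.val : ℕ) : ZMod 8) := (ZMod.natCast_zmod_val (n := 8) x).symm
  rw [hx, h]
  fin_cases x
  · simp
  · simp
  · simpa using p2
  · simpa using p3
  · simpa using p4
  · simp [pow_succ _ 4, p4]
  · simpa [p4, p2] using pow_add ((√2 : ℂ) / 2 * (1 + I)) 4 2
  · simpa [p4, p3] using pow_add ((√2 : ℂ) / 2 * (1 + I)) 4 3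

open Complex in
theorem isSelfDual_χ₄ : IsSelfDual 4 (fun n => ZMod.χ₄ n) (2 * I) := by
  refine isSelfDual_of_mulChar ZMod.χ₄ fun k => ?_
  have hχ : ∀ j : ZMod 4, ZMod.χ₄ j = (![0, 1, 0, -1] : Fin 4 → ℤ) j := fun j => by fin_cases j <;> rfl
  rw [hχ k]
  have key : ∀ k : Fin 4, ∑ j : Fin 4, (![1, I, -1, -I] : Fin 4 → ℂ) (j * k) *
      (((![0, 1, 0, -1] : Fin 4 → ℤ) j : ℤ) : ℂ) =
      2 * I * (((![0, 1, 0, -1] : Fin 4 → ℤ) k : ℤ) : ℂ) := by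
    intro k
    rw [Fin.sum_univ_four]
    fin_cases k <;> simp <;> ring
  refine Eq.trans ?_ (key k)
  exact Finset.sum_congr rfl fun j _ => by
    rw [hχ j]
    exact congrArg (· * _) (stdAddChar_four (j * k))

theorem sqrt_eight : √(8 : ℝ) = 2 * √2 := by
  rw [show (8 : ℝ) = 2 ^ 2 * 2 by norm_num, Real.sqrt_mul (by norm_num),
    Real.sqrt_sq (by norm_num)]

open Complex in
theorem isSelfDual_χ₈ : IsSelfDual 8 (fun n => ZMod.χ₈ n) (√(8 : ℝ) : ℂ) := by
  refine isSelfDual_of_mulChar ZMod.χ₈ fun k => ?_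
  have hχ : ∀ j : ZMod 8, ZMod.χ₈ j = (![0, 1, 0, -1, 0, -1, 0, 1] : Fin 8 → ℤ) j := fun j => by fin_cases j <;> rfl
  rw [hχ k]
  have key : ∀ k : Fin 8, ∑ j : Fin 8, (![1, (√2 : ℂ) / 2 * (1 + I), I, (√2 : ℂ) / 2 * (-1 + I),
      -1, -((√2 : ℂ) / 2 * (1 + I)), -I, -((√2 : ℂ) / 2 * (-1 + I))] : Fin 8 → ℂ) (j * k) *
      (((![0, 1, 0, -1, 0, -1, 0, 1] : Fin 8 → ℤ) j : ℤ) : ℂ) =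
      (√(8 : ℝ) : ℂ) * (((![0, 1, 0, -1, 0, -1, 0, 1] : Fin 8 → ℤ) k : ℤ) : ℂ) := by
    intro k
    rw [Fin.sum_univ_eight, sqrt_eight]
    push_cast
    fin_cases k <;> simp <;> ring
  refine Eq.trans ?_ (key k)
  exact Finset.sum_congr rfl fun j _ => by
    rw [hχ j]
    exact congrArg (· * _) (stdAddChar_eight (j * k))

open Complex in
theorem isSelfDual_χ₈' : IsSelfDual 8 (fun n => ZMod.χ₈' n) (I * (√(8 : ℝ) : ℂ)) := by
  refine isSelfDual_of_mulChar ZMod.χ₈' fun k => ?_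
  have hχ : ∀ j : ZMod 8, ZMod.χ₈' j = (![0, 1, 0, 1, 0, -1, 0, -1] : Fin 8 → ℤ) j := fun j => by fin_cases j <;> rfl
  rw [hχ k]
  have key : ∀ k : Fin 8, ∑ j : Fin 8, (![1, (√2 : ℂ) / 2 * (1 + I), I, (√2 : ℂ) / 2 * (-1 + I),
      -1, -((√2 : ℂ) / 2 * (1 + I)), -I, -((√2 : ℂ) / 2 * (-1 + I))] : Fin 8 → ℂ) (j * k) *
      (((![0, 1, 0, 1, 0, -1, 0, -1] : Fin 8 → ℤ) j : ℤ) : ℂ) =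
      I * (√(8 : ℝ) : ℂ) * (((![0, 1, 0, 1, 0, -1, 0, -1] : Fin 8 → ℤ) k : ℤ) : ℂ) := by
    intro k
    rw [Fin.sum_univ_eight, sqrt_eight]
    push_cast
    fin_cases k <;> simp <;> ring
  refine Eq.trans ?_ (key k)
  exact Finset.sum_congr rfl fun j _ => by
    rw [hχ j]
    exact congrArg (· * _) (stdAddChar_eight (j * k))

theorem IsSelfDual.dft_eq_neg {N : ℕ} [NeZero N] {f : ℕ → ℤ}
    (hf : IsSelfDual N f (√(N : ℝ) : ℂ)) :
    ZMod.dft (fun j : ZMod N => (f j.val : ℂ)) =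
      fun k => (√(N : ℝ) : ℂ) * (fun j : ZMod N => (f j.val : ℂ)) (-k) := by
  funext k
  have h := hf.sum_eq (-k).val
  rw [ZMod.natCast_zmod_val] at h
  rw [ZMod.dft_apply, ← h]
  simp

/-- Two Fourier transforms send `Φ` to `N Φ(-k)`, whereas squaring the eigenvalue relation gives `N
Φ(k)`. So the eigenvalue `√N` forces evenness. -/
theorem IsSelfDual.even {N : ℕ} [NeZero N] {f : ℕ → ℤ}
    (hf : IsSelfDual N f (√(N : ℝ) : ℂ)) : (fun j : ZMod N => (f j.val : ℂ)).Even := by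
  set Φ : ZMod N → ℂ := fun j => (f j.val : ℂ) with hΦ
  have hN : (N : ℂ) ≠ 0 := NeZero.ne _
  have hs : (√(N : ℝ) : ℂ) * (√(N : ℝ) : ℂ) = N := by
    rw [← Complex.ofReal_mul, Real.mul_self_sqrt (Nat.cast_nonneg N), Complex.ofReal_natCast]
  intro k
  have h1 := congrFun (ZMod.dft_dft Φ) k
  have h2 := congrFun hf.dft_eq_neg
  have h3 : ZMod.dft (ZMod.dft Φ) k = (√(N : ℝ) : ℂ) * ZMod.dft Φ (-k) := by
    conv_lhs => rw [hf.dft_eq_neg]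
    rw [ZMod.dft_const_mul]
    exact congrArg _ (congrFun (ZMod.dft_comp_neg Φ) k)
  rw [h3, h2, neg_neg, ← mul_assoc, hs, smul_eq_mul] at h1
  exact (mul_left_cancel₀ hN h1).symm

theorem IsSelfDual.dft_eq {N : ℕ} [NeZero N] {f : ℕ → ℤ}
    (hf : IsSelfDual N f (√(N : ℝ) : ℂ)) :
    ZMod.dft (fun j : ZMod N => (f j.val : ℂ)) =
      fun k => (√(N : ℝ) : ℂ) * (fun j : ZMod N => (f j.val : ℂ)) k := by
  rw [hf.dft_eq_neg]
  funext k
  rw [hf.even k]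

theorem Nat.odd_mod_four {n : ℕ} (hn : Odd n) : n % 4 = 1 ∨ n % 4 = 3 := by
  have := Nat.odd_iff.1 hn
  omega

theorem kroneckerSym_four_mul {k : ℕ} (hk : k % 4 = 3) (n : ℕ) :
    kroneckerSym ((4 * k : ℕ) : ℤ) n = ZMod.χ₄ n * J(n | k) := by
  rcases Nat.even_or_odd n with hn | hn
  · rw [kroneckerSym_even hn, ZMod.χ₄_nat_eq_if_mod_four, if_pos (Nat.even_iff.1 hn), zero_mul]
  · rw [kroneckerSym_of_odd _ hn, Nat.cast_mul, jacobiSym.mul_left]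
    have h4 : J(((4 : ℕ) : ℤ) | n) = 1 := jacobiSym.at_four hn
    have hkodd : Odd k := Nat.odd_iff.2 (by omega)
    rw [h4, one_mul]
    rcases Nat.odd_mod_four hn with h | h
    · rw [ZMod.χ₄_nat_one_mod_four h, one_mul,
        jacobiSym.quadratic_reciprocity_one_mod_four' hkodd h]
    · rw [ZMod.χ₄_nat_three_mod_four h, neg_one_mul,
        jacobiSym.quadratic_reciprocity_three_mod_four hk h]

theorem ZMod.χ₈'_eq_mul (n : ℕ) : ZMod.χ₈' n = ZMod.χ₄ n * ZMod.χ₈ n := by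
  rw [ZMod.χ₈'_nat_eq_if_mod_eight, ZMod.χ₄_nat_eq_if_mod_four, ZMod.χ₈_nat_eq_if_mod_eight]
  split_ifs <;> first | rfl | omega

theorem kroneckerSym_eight_mul {l : ℕ} (hl : Odd l) (n : ℕ) :
    kroneckerSym ((8 * l : ℕ) : ℤ) n =
      (if l % 4 = 1 then ZMod.χ₈ n else ZMod.χ₈' n) * J(n | l) := by
  rcases Nat.even_or_odd n with hn | hn
  · have h2 := Nat.even_iff.1 hn
    rw [show 8 * l = 4 * (2 * l) by ring, kroneckerSym_even hn, ZMod.χ₈_nat_eq_if_mod_eight,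
      ZMod.χ₈'_nat_eq_if_mod_eight, if_pos h2, if_pos h2, ite_self, zero_mul]
  · rw [kroneckerSym_of_odd _ hn]
    have h4 : J(4 | n) = 1 := jacobiSym.at_four hn
    have h8 : J(((8 * l : ℕ) : ℤ) | n) = ZMod.χ₈ n * J(l | n) := by
      rw [show ((8 * l : ℕ) : ℤ) = 4 * (2 * (l : ℤ)) by push_cast; ring, jacobiSym.mul_left,
        jacobiSym.mul_left, h4, one_mul, jacobiSym.at_two hn]
    rw [h8]
    rcases Nat.odd_mod_four hl with h | h
    · rw [if_pos h, jacobiSym.quadratic_reciprocity_one_mod_four h hn]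
    · rw [if_neg (by omega), ZMod.χ₈'_eq_mul]
      rcases Nat.odd_mod_four hn with h' | h'
      · rw [ZMod.χ₄_nat_one_mod_four h', one_mul,
          jacobiSym.quadratic_reciprocity_one_mod_four' hl h']
      · rw [ZMod.χ₄_nat_three_mod_four h', jacobiSym.quadratic_reciprocity_three_mod_four h h']
        ring

open Complex in
/-- The root number of the Kronecker symbol of a positive fundamental discriminant is one. -/
theorem isSelfDual_kroneckerSym {d : ℕ} [NeZero d] (hd : IsFundamentalDiscriminant (d : ℤ)) :
    IsSelfDual d (kroneckerSym d) (√(d : ℝ) : ℂ) := by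
  have hd0 : d ≠ 0 := NeZero.ne d
  -- The factorisations are `(·/d)` for `d ≡ 1 (mod 4)`; `χ₈ (·/l)` or `χ₈' (·/l)` for `d = 8l`,
  -- according as `l ≡ 1` or `3 (mod 4)`; and `χ₄ (·/k)` for `d = 4k` with `k ≡ 3 (mod 4)`. Whenever
  -- an odd character at `2` occurs, its `i`, the `i` of the odd part and the cross sign `-1`
  -- multiply to `1`.
  rcases hd with ⟨h1, h2⟩ | ⟨m, hm, hm4, hsq⟩
  · have h1' : d % 4 = 1 := by omega
    have h := isSelfDual_jacobiSym d (Nat.odd_iff.2 (by omega)) (Int.squarefree_natCast.1 h2)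
    rw [gaussEpsilon, if_pos h1', one_mul] at h
    have hfun : kroneckerSym d = fun n : ℕ => J(n | d) :=
      funext fun n => kroneckerSym_eq_jacobiSym h1' n
    rwa [hfun]
  · obtain ⟨k, rfl⟩ : ∃ k : ℕ, m = k := ⟨m.toNat, by omega⟩
    rw [Int.squarefree_natCast] at hsq
    obtain rfl : d = 4 * k := by omega
    rcases hm4 with hm4 | hm4
    · obtain ⟨l, rfl⟩ : ∃ l, k = 2 * l := ⟨k / 2, by omega⟩
      have hl : Odd l := Nat.odd_iff.2 (by omega)
      have hsl : Squarefree l := (Nat.squarefree_mul_iff.1 hsq).2.2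
      have : NeZero l := ⟨by rintro rfl; simp at hl⟩
      have hcop : Nat.Coprime 8 l := by
        rw [show 8 = 2 ^ 3 by norm_num]
        exact Nat.Coprime.pow_left 3 hl.coprime_two_left
      have hsq8 : ((J(((8 : ℕ) : ℤ) | l) : ℤ) : ℂ) = ZMod.χ₈ l := by
        have h4 : J(4 | l) = 1 := jacobiSym.at_four hl
        rw [show (((8 : ℕ) : ℤ)) = 4 * 2 by norm_num, jacobiSym.mul_left, h4, one_mul,
          jacobiSym.at_two hl]
      have hχsq : ((ZMod.χ₈ l : ℤ) : ℂ) * (ZMod.χ₈ l : ℤ) = 1 := by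
        rw [← jacobiSym.at_two hl, ← pow_two]
        exact_mod_cast jacobiSym.sq_one (a := 2) (b := l)
          (by exact_mod_cast hl.coprime_two_left)
      have hsqrt : (√((4 * (2 * l) : ℕ) : ℝ) : ℂ) = (√(8 : ℝ) : ℂ) * (√(l : ℝ) : ℂ) := by
        rw [← ofReal_mul, ← Real.sqrt_mul (by norm_num)]
        congr 2
        push_cast
        ring
      have h8 : 4 * (2 * l) = 8 * l := by ring
      have hjac := isSelfDual_jacobiSym l hl hsl
      rcases Nat.odd_mod_four hl with h | h
      · have hfun : kroneckerSym ((4 * (2 * l) : ℕ) : ℤ) =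
            fun n : ℕ => ZMod.χ₈ n * J(n | l) := by
          funext n
          rw [h8, kroneckerSym_eight_mul hl, if_pos h]
        have hp := isSelfDual_χ₈.mul hcop hjac
        rw [gaussEpsilon, if_pos h, one_mul, hsq8, mul_assoc (_ * _) ((ZMod.χ₈ l : ℤ) : ℂ), hχsq,
          mul_one, ← hsqrt, ← hfun] at hp
        convert hp using 1
      · have hfun : kroneckerSym ((4 * (2 * l) : ℕ) : ℤ) =
            fun n : ℕ => ZMod.χ₈' n * J(n | l) := by
          funext n
          rw [h8, kroneckerSym_eight_mul hl, if_neg (by omega)]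
        have hp := isSelfDual_χ₈'.mul hcop hjac
        have hc : I * (√(8 : ℝ) : ℂ) * (gaussEpsilon l * (√(l : ℝ) : ℂ)) *
            ((ZMod.χ₈' l : ℤ) : ℂ) * ((J(((8 : ℕ) : ℤ) | l) : ℤ) : ℂ) =
            (√((4 * (2 * l) : ℕ) : ℝ) : ℂ) := by
          rw [gaussEpsilon, if_neg (by omega), hsq8, ZMod.χ₈'_eq_mul,
            ZMod.χ₄_nat_three_mod_four h, hsqrt]
          push_cast
          linear_combination ((√(8 : ℝ) : ℂ) * (√(l : ℝ) : ℂ)) * hχsq -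
            ((√(8 : ℝ) : ℂ) * (√(l : ℝ) : ℂ) * ((ZMod.χ₈ l : ℤ) : ℂ) * (ZMod.χ₈ l : ℤ)) * I_sq
        rw [hc, ← hfun] at hp
        convert hp using 1
    · have hm4' : k % 4 = 3 := by omega
      have hk : Odd k := Nat.odd_iff.2 (by omega)
      have : NeZero k := ⟨by rintro rfl; simp at hk⟩
      have hcop : Nat.Coprime 4 k := by
        rw [show 4 = 2 ^ 2 by norm_num]
        exact Nat.Coprime.pow_left 2 hk.coprime_two_left
      have hp := isSelfDual_χ₄.mul hcop (isSelfDual_jacobiSym k hk hsq)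
      have hfun : kroneckerSym ((4 * k : ℕ) : ℤ) = fun n : ℕ => ZMod.χ₄ n * J(n | k) :=
        funext fun n => kroneckerSym_four_mul hm4' n
      have hc : 2 * I * (gaussEpsilon k * (√(k : ℝ) : ℂ)) *
            ((ZMod.χ₄ k : ℤ) : ℂ) * ((J(((4 : ℕ) : ℤ) | k) : ℤ) : ℂ) =
            (√((4 * k : ℕ) : ℝ) : ℂ) := by
        have h4 : J(((4 : ℕ) : ℤ) | k) = 1 := jacobiSym.at_four hk
        have hs : √((4 * k : ℕ) : ℝ) = 2 * √(k : ℝ) := by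
          rw [Nat.cast_mul, show ((4 : ℕ) : ℝ) = 2 ^ 2 by norm_num, Real.sqrt_mul (by norm_num),
            Real.sqrt_sq (by norm_num)]
        rw [gaussEpsilon, if_neg (by omega), h4, ZMod.χ₄_nat_three_mod_four hm4', hs]
        push_cast
        linear_combination (-2 * (√(k : ℝ) : ℂ)) * I_sq
      rw [hc, ← hfun] at hp
      exact hp

/-! ### Conjugation, parity, and the logarithmic derivative at `s = 2`. -/

open Complex ComplexConjugate in
/-- An `L`-function with real coefficients commutes with complex conjugation. -/
theorem ZMod.LFunction_conj {N : ℕ} [NeZero N] {Φ : ZMod N → ℂ} (hreal : ∀ j, conj (Φ j) = Φ j)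
    (hsum : ∑ j, Φ j = 0) (s : ℂ) :
    ZMod.LFunction Φ (conj s) = conj (ZMod.LFunction Φ s) := by
  have hd := ZMod.differentiable_LFunction_of_sum_zero hsum
  have hd' : Differentiable ℂ (conj ∘ ZMod.LFunction Φ ∘ conj) := fun z =>
    differentiableAt_conj_conj_iff.2 (hd _)
  have hev : conj ∘ ZMod.LFunction Φ ∘ conj =ᶠ[nhds 2] ZMod.LFunction Φ := by
    filter_upwards [(isOpen_lt continuous_const continuous_re).mem_nhds
      (show (1 : ℝ) < (2 : ℂ).re by norm_num)] with z hz
    have hz1 : 1 < z.re := hz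
    simp only [Function.comp_apply]
    rw [ZMod.LFunction_eq_LSeries Φ hz1, ZMod.LFunction_eq_LSeries Φ (by simpa using hz1),
      LSeries, LSeries, conj_tsum]
    refine tsum_congr fun n => ?_
    rcases eq_or_ne n 0 with rfl | hn
    · simp
    · rw [LSeries.term_of_ne_zero hn, LSeries.term_of_ne_zero hn, map_div₀, hreal,
        cpow_conj _ _ (by rw [natCast_arg]; exact Real.pi_ne_zero.symm), conj_natCast, conj_conj]
  have heq := (hd'.differentiableOn.analyticOnNhd isOpen_univ).eqOn_of_preconnected_of_eventuallyEq
    (hd.differentiableOn.analyticOnNhd isOpen_univ) isPreconnected_univ (Set.mem_univ 2) hev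
    (Set.mem_univ s)
  rw [← heq]
  simp

open Complex Filter Topology in
/-- An even function has no zero of odd order at the origin. -/
theorem not_exists_odd_pow_mul_of_even {F H : ℂ → ℂ} (hF : ∀ w, F (-w) = F w) {m : ℕ}
    (hm : Odd m) (hH : ContinuousAt H 0) (hH0 : H 0 ≠ 0)
    (hFH : ∀ᶠ w in 𝓝 0, F w = w ^ m * H w) : False := by
  have hneg : Tendsto (fun w : ℂ => -w) (𝓝 0) (𝓝 0) := by
    simpa using (continuous_neg (G := ℂ)).tendsto 0
  -- Evenness of `F` with odd `m` makes the cofactor odd off the origin; by continuity `2 H(0) = 0`.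
  have h1 : ∀ᶠ w in 𝓝[≠] (0 : ℂ), H w + H (-w) = 0 := by
    have h2 := (hFH.and (hneg.eventually hFH)).filter_mono
      (nhdsWithin_le_nhds (s := {0}ᶜ))
    filter_upwards [h2, self_mem_nhdsWithin] with w hw hw0
    have h3 := hF w
    rw [hw.1, hw.2, hm.neg_pow] at h3
    have h4 : w ^ m * (H w + H (-w)) = 0 := by linear_combination -h3
    exact (mul_eq_zero.1 h4).resolve_left (pow_ne_zero _ hw0)
  have h5 : Tendsto (fun w => H w + H (-w)) (𝓝[≠] 0) (𝓝 (H 0 + H 0)) :=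
    (hH.tendsto.add (hH.tendsto.comp hneg)).mono_left nhdsWithin_le_nhds
  have h6 := tendsto_nhds_unique (h5.congr' h1) tendsto_const_nhds
  exact hH0 (by linear_combination h6 / 2)

/-- A `finsum` with infinite support is `0` by convention, so the empty set serves in that case. -/
theorem exists_finset_finsum_mem_eq {α : Type*} (s : Set α) (f : α → ℝ) :
    ∃ A : Finset α, ↑A ⊆ s ∧ ∑ᶠ i ∈ s, f i = ∑ i ∈ A, f i := by
  by_cases h : (s ∩ Function.support f).Finite
  · refine ⟨h.toFinset, by simp, ?_⟩
    rw [← finsum_mem_inter_support, finsum_mem_eq_finite_toFinset_sum _ h]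
  · exact ⟨∅, by simp, by simpa using finsum_mem_eq_zero_of_infinite h⟩

section Kronecker

open Complex

variable {N : ℕ} [NeZero N] {Φ : ZMod N → ℂ}

theorem completedLFunction_eq_LFunction_mul (hΦ : Φ.Even) {s : ℂ} (hs : 0 < s.re) :
    ZMod.completedLFunction Φ s = ZMod.LFunction Φ s * Gammaℝ s := by
  rw [ZMod.LFunction_eq_completed_div_gammaFactor_even hΦ s
    (Or.inl (by rintro rfl; simp at hs)), div_mul_cancel₀ _ (Gammaℝ_ne_zero_of_re_pos hs)]

theorem centeredXi_eq_LFunction_mul (hΦ : Φ.Even) {w : ℂ} (hw : -(1 / 2) < w.re) :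
    centeredXi Φ w =
      (N : ℂ) ^ (w / 2) * (ZMod.LFunction Φ (1 / 2 + w) * Gammaℝ (1 / 2 + w)) := by
  rw [centeredXi, completedLFunction_eq_LFunction_mul hΦ]
  simp
  linarith

theorem centeredXi_eq_zero_iff (hΦ : Φ.Even) {w : ℂ} (hw : -(1 / 2) < w.re) :
    centeredXi Φ w = 0 ↔ ZMod.LFunction Φ (1 / 2 + w) = 0 := by
  have hG : Gammaℝ (1 / 2 + w) ≠ 0 := Gammaℝ_ne_zero_of_re_pos (by simp; linarith)
  have hN : (N : ℂ) ≠ 0 := NeZero.ne _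
  rw [centeredXi_eq_LFunction_mul hΦ hw]
  rw [mul_eq_zero, mul_eq_zero, or_iff_left hG, or_iff_right]
  simp [cpow_eq_zero_iff, hN]

/-- Euler's constant enters the criterion here, through `Γ'(1)`. -/
theorem logDeriv_Gammaℝ_two :
    logDeriv Gammaℝ 2 = -(Real.log Real.pi : ℂ) / 2 - Real.eulerMascheroniConstant / 2 := by
  have hpi : (Real.pi : ℂ) ≠ 0 := ofReal_ne_zero.2 Real.pi_ne_zero
  have h1 : HasDerivAt (fun s : ℂ => (Real.pi : ℂ) ^ (-s / 2))
      ((Real.pi : ℂ) ^ (-(2 : ℂ) / 2) * log Real.pi * (-1 / 2)) 2 :=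
    (((hasDerivAt_id (2 : ℂ)).neg).div_const 2).const_cpow (Or.inl hpi)
  have h2 : HasDerivAt (fun s : ℂ => Gamma (s / 2))
      (-Real.eulerMascheroniConstant * (1 / 2)) 2 := by
    have hG : HasDerivAt Gamma (-Real.eulerMascheroniConstant : ℂ) (2 / 2) := by
      rw [div_self two_ne_zero]
      exact hasDerivAt_Gamma_one
    exact HasDerivAt.comp (2 : ℂ) hG ((hasDerivAt_id (2 : ℂ)).div_const 2)
  have h3 := h1.mul h2
  have hdef : Gammaℝ = fun s : ℂ => (Real.pi : ℂ) ^ (-s / 2) * Gamma (s / 2) :=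
    funext Gammaℝ_def
  rw [logDeriv_apply, Gammaℝ_def]
  conv_lhs => rw [hdef]
  have h4 : deriv (fun s : ℂ => (Real.pi : ℂ) ^ (-s / 2) * Gamma (s / 2)) 2 = _ := h3.deriv
  rw [h4, div_self two_ne_zero, Gamma_one, ofReal_log Real.pi_pos.le]
  have hp : (Real.pi : ℂ) ^ (-(2 : ℂ) / 2) ≠ 0 := by simp [cpow_eq_zero_iff, hpi]
  field_simp
  ring

theorem logDeriv_centeredXi (hΦ : Φ.Even) (hd : Differentiable ℂ (ZMod.LFunction Φ))
    (hL : ZMod.LFunction Φ 2 ≠ 0) :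
    logDeriv (centeredXi Φ) (3 / 2) =
      (Real.log N : ℂ) / 2 + logDeriv (ZMod.LFunction Φ) 2 + logDeriv Gammaℝ 2 := by
  have hN : (N : ℂ) ≠ 0 := NeZero.ne _
  have h32 : (1 : ℂ) / 2 + 3 / 2 = 2 := by norm_num
  have hG : Gammaℝ 2 ≠ 0 := Gammaℝ_ne_zero_of_re_pos (by simp)
  have hGd : DifferentiableAt ℂ Gammaℝ 2 := by
    have h := (differentiable_Gammaℝ_inv 2).inv (inv_ne_zero hG)
    simpa only [Pi.inv_def, inv_inv] using h
  have hev : centeredXi Φ =ᶠ[nhds (3 / 2)] fun w =>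
      (N : ℂ) ^ (w / 2) * ((ZMod.LFunction Φ ∘ fun w => 1 / 2 + w) w *
        (Gammaℝ ∘ fun w => 1 / 2 + w) w) := by
    filter_upwards [(isOpen_lt continuous_const continuous_re).mem_nhds
      (show (-(1 / 2) : ℝ) < ((3 / 2 : ℂ)).re by norm_num)] with w hw
    exact centeredXi_eq_LFunction_mul hΦ hw
  have hcpow : HasDerivAt (fun w : ℂ => (N : ℂ) ^ (w / 2))
      ((N : ℂ) ^ ((3 / 2 : ℂ) / 2) * log N * (1 / 2)) (3 / 2) :=
    ((hasDerivAt_id (3 / 2 : ℂ)).div_const 2).const_cpow (Or.inl hN)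
  have hcpow0 : (N : ℂ) ^ ((3 / 2 : ℂ) / 2) ≠ 0 := by simp [cpow_eq_zero_iff, hN]
  have hshift : DifferentiableAt ℂ (fun w : ℂ => 1 / 2 + w) (3 / 2) := by fun_prop
  have hshift' : deriv (fun w : ℂ => 1 / 2 + w) (3 / 2) = 1 := by simp
  have hd1 : DifferentiableAt ℂ (ZMod.LFunction Φ ∘ fun w => 1 / 2 + w) (3 / 2) :=
    DifferentiableAt.comp _ (hd _) hshift
  have hd2 : DifferentiableAt ℂ (Gammaℝ ∘ fun w => 1 / 2 + w) (3 / 2) :=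
    DifferentiableAt.comp _ (by rw [h32]; exact hGd) hshift
  have e1 : (ZMod.LFunction Φ ∘ fun w => 1 / 2 + w) (3 / 2) ≠ 0 := by
    rw [Function.comp_apply, h32]; exact hL
  have e2 : (Gammaℝ ∘ fun w => 1 / 2 + w) (3 / 2) ≠ 0 := by
    rw [Function.comp_apply, h32]; exact hG
  have e3 := logDeriv_mul (f := fun w : ℂ => (N : ℂ) ^ (w / 2)) (g := fun w =>
    (ZMod.LFunction Φ ∘ fun w => 1 / 2 + w) w * (Gammaℝ ∘ fun w => 1 / 2 + w) w) (3 / 2)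
    hcpow0 (mul_ne_zero e1 e2) hcpow.differentiableAt (hd1.mul hd2)
  rw [(logDeriv_congr_nhds hev).eq_of_nhds, e3, logDeriv_mul _ e1 e2 hd1 hd2,
    logDeriv_comp (by rw [h32]; exact hd _) hshift, logDeriv_comp (by rw [h32]; exact hGd) hshift,
    hshift', h32, logDeriv_apply, hcpow.deriv]
  have hlog : log (N : ℂ) = Real.log N := by
    rw [ofReal_log (Nat.cast_nonneg N), ofReal_natCast]
  rw [hlog, mul_assoc, mul_div_cancel_left₀ _ hcpow0]
  ring

end Kronecker

/-! ### Lower bounds for the contributions of zeros. -/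

open Complex in
/-- Zeros in the upper half-plane of an even entire function contribute in symmetric pairs. -/
theorem sum_re_le_re_logDeriv_of_im_pos {F : ℂ → ℂ} (hF : Differentiable ℂ F)
    (heven : ∀ w, F (-w) = F w) {C : ℝ} (hC : 0 ≤ C)
    (hgrowth : ∀ w, ‖F w‖ ≤ Real.exp (C * (1 + ‖w‖) ^ (3 / 2 : ℝ)))
    {x : ℝ} (hx : 0 < x) (hzero : ∀ a, F a = 0 → |a.re| < x)
    (S : Finset ℂ) (hS : ∀ a ∈ S, F a = 0 ∧ 0 < a.im) :
    ∑ a ∈ S, ((1 / (x - a)).re + (1 / (x + a)).re) ≤ (logDeriv F x).re := by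
  classical
  have hdisj : Disjoint S (S.image fun a => -a) := by
    rw [Finset.disjoint_left]
    intro a ha ha'
    obtain ⟨b, hb, rfl⟩ := Finset.mem_image.1 ha'
    have h1 := (hS _ ha).2
    have h2 := (hS _ hb).2
    rw [neg_im] at h1
    linarith
  have h := sum_re_le_re_logDeriv hF heven hC hgrowth hx hzero (S ∪ S.image fun a => -a) (by
    intro a ha
    rcases Finset.mem_union.1 ha with ha | ha
    · exact (hS a ha).1
    · obtain ⟨b, hb, rfl⟩ := Finset.mem_image.1 ha
      rw [heven]
      exact (hS b hb).1)
  rw [Finset.sum_union hdisj, Finset.sum_image (fun a _ b _ hab => neg_injective hab)] at h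
  refine le_trans (le_of_eq ?_) h
  rw [← Finset.sum_add_distrib]
  refine Finset.sum_congr rfl fun a _ => ?_
  rw [sub_neg_eq_add, ← sub_eq_add_neg]
  ring

open Complex in
theorem re_one_div_sub (x a b : ℝ) :
    (1 / ((x : ℂ) - (a + b * I))).re = (x - a) / ((x - a) ^ 2 + b ^ 2) := by
  rw [one_div, inv_re, normSq_apply]
  simp
  ring

open Complex in
theorem re_one_div_add (x a b : ℝ) :
    (1 / ((x : ℂ) + (a + b * I))).re = (x + a) / ((x + a) ^ 2 + b ^ 2) := by
  rw [one_div, inv_re, normSq_apply]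
  simp
  ring

theorem iotaMin_anti {a b : ℝ} (ha : 0 ≤ a) (hab : a ≤ b) : iotaMin b ≤ iotaMin a := by
  unfold iotaMin
  gcongr

theorem iotaMin_pos (a : ℝ) : 0 < iotaMin a :=
  lt_min (by positivity) (by positivity)

/-- The contribution of a zero off the critical line is at least `iotaMin`. -/
theorem iotaMin_le {x b : ℝ} (hx : |x| < 1 / 2) :
    iotaMin b ≤ (3 / 2 - x) / ((3 / 2 - x) ^ 2 + b ^ 2) + (3 / 2 + x) / ((3 / 2 + x) ^ 2 + b ^ 2) := by
  obtain ⟨hx1, hx2⟩ := abs_lt.1 hx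
  set m := iotaMin b
  have hm : 0 < m := iotaMin_pos b
  have h1 : m ≤ 1 / (1 + b ^ 2) + 2 / (4 + b ^ 2) := min_le_left _ _
  have h2 : m ≤ 12 / (9 + 4 * b ^ 2) := min_le_right _ _
  have hb := sq_nonneg b
  have e1 : m * ((1 + b ^ 2) * (4 + b ^ 2)) ≤ 6 + 3 * b ^ 2 := by
    rw [div_add_div _ _ (by positivity) (by positivity), le_div_iff₀ (by positivity)] at h1
    linarith
  have e2 : m * (9 + 4 * b ^ 2) ≤ 12 := by
    rwa [le_div_iff₀ (by positivity)] at h2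
  have hy : x ^ 2 ≤ 1 / 4 := by nlinarith
  have hp : 0 < (3 / 2 - x) ^ 2 + b ^ 2 := by
    have : 0 < 3 / 2 - x := by linarith
    positivity
  have hq : 0 < (3 / 2 + x) ^ 2 + b ^ 2 := by
    have : 0 < 3 / 2 + x := by linarith
    positivity
  rw [div_add_div _ _ hp.ne' hq.ne', le_div_iff₀ (mul_pos hp hq)]
  -- With `y = x²`, numerator minus `m` times denominator is a concave quadratic in `y` on `[0,
  -- 1/4]`. `k1` and `k2` are its endpoint values at `y = 0` and `y = 1/4`, up to constants,
  -- weighted as on the chord; `k3` is the excess `m y (1/4 - y)` over the chord. The endpoints give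
  -- the two terms of the minimum in `iotaMin`.
  have k1 : 0 ≤ (1 - 4 * x ^ 2) * ((12 - m * (9 + 4 * b ^ 2)) * (9 + 4 * b ^ 2)) :=
    mul_nonneg (by linarith) (mul_nonneg (by linarith) (by linarith))
  have k2 : 0 ≤ x ^ 2 * (6 + 3 * b ^ 2 - m * ((1 + b ^ 2) * (4 + b ^ 2))) :=
    mul_nonneg (sq_nonneg x) (by linarith)
  have k3 : 0 ≤ m * (x ^ 2 * (1 / 4 - x ^ 2)) :=
    mul_nonneg hm.le (mul_nonneg (sq_nonneg x) (by linarith))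
  nlinarith

/-! ### The function `ξ` of a Kronecker symbol. -/

theorem kroneckerSym_zero {d : ℕ} (hd1 : d ≠ 1) : kroneckerSym d 0 = 0 := by
  simp [kroneckerSym, hd1]

section Main

open Complex

variable {d : ℕ} [NeZero d]

theorem kroneckerChar_apply (hd : IsFundamentalDiscriminant (d : ℤ)) :
    (kroneckerChar d hd : ZMod d → ℂ) = fun j : ZMod d => (kroneckerSym d j.val : ℂ) := rfl

theorem kroneckerChar_even (hd : IsFundamentalDiscriminant (d : ℤ)) :
    Function.Even (kroneckerChar d hd : ZMod d → ℂ) :=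
  (isSelfDual_kroneckerSym hd).even

theorem dft_kroneckerChar (hd : IsFundamentalDiscriminant (d : ℤ)) :
    ZMod.dft (kroneckerChar d hd : ZMod d → ℂ) =
      fun k => (√(d : ℝ) : ℂ) * kroneckerChar d hd k :=
  (isSelfDual_kroneckerSym hd).dft_eq

theorem kroneckerChar_zero (hd : IsFundamentalDiscriminant (d : ℤ)) (hd1 : d ≠ 1) :
    kroneckerChar d hd 0 = 0 := by
  rw [kroneckerChar_apply]
  simp [kroneckerSym_zero hd1]

theorem sum_kroneckerChar (hd : IsFundamentalDiscriminant (d : ℤ)) (hd1 : d ≠ 1) :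
    ∑ j, kroneckerChar d hd j = 0 :=
  sum_eq_zero_of_dft_eq (kroneckerChar_zero hd hd1) (dft_kroneckerChar hd)

theorem kroneckerChar_ne_one (hd : IsFundamentalDiscriminant (d : ℤ)) (hd1 : d ≠ 1) :
    kroneckerChar d hd ≠ 1 := by
  classical
  intro h
  have h1 := sum_kroneckerChar hd hd1
  rw [h, MulChar.sum_one_eq_card_units] at h1
  exact Fintype.card_ne_zero (Nat.cast_eq_zero.1 h1)

theorem kroneckerChar_conj (hd : IsFundamentalDiscriminant (d : ℤ)) (j : ZMod d) :
    (starRingEnd ℂ) (kroneckerChar d hd j) = kroneckerChar d hd j := by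
  rw [kroneckerChar_apply]
  simp

/-- The completed `L`-function of the Kronecker symbol, centred at `1 / 2`. -/
noncomputable def kroneckerXi (d : ℕ) [NeZero d] (hd : IsFundamentalDiscriminant (d : ℤ)) :
    ℂ → ℂ := centeredXi (kroneckerChar d hd)

theorem kroneckerXi_neg (hd : IsFundamentalDiscriminant (d : ℤ)) (hd1 : d ≠ 1) (w : ℂ) :
    kroneckerXi d hd (-w) = kroneckerXi d hd w :=
  centeredXi_neg (kroneckerChar_even hd) (kroneckerChar_zero hd hd1) (dft_kroneckerChar hd) w

theorem kroneckerXi_eq_zero_iff (hd : IsFundamentalDiscriminant (d : ℤ)) {w : ℂ}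
    (hw : -(1 / 2) < w.re) :
    kroneckerXi d hd w = 0 ↔ (kroneckerChar d hd).LFunction (1 / 2 + w) = 0 :=
  centeredXi_eq_zero_iff (kroneckerChar_even hd) hw

/-- Nonvanishing of `L` on `Re s ≥ 1` bounds one side, and evenness of `ξ` the other. -/
theorem abs_re_lt_of_kroneckerXi_eq_zero (hd : IsFundamentalDiscriminant (d : ℤ)) (hd1 : d ≠ 1)
    {w : ℂ} (h : kroneckerXi d hd w = 0) : |w.re| < 1 / 2 := by
  have key : ∀ z : ℂ, kroneckerXi d hd z = 0 → z.re < 1 / 2 := by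
    intro z hz
    by_contra! hre
    rw [kroneckerXi_eq_zero_iff hd (by linarith)] at hz
    exact DirichletCharacter.LFunction_ne_zero_of_one_le_re _
      (Or.inl (kroneckerChar_ne_one hd hd1)) (by simp; linarith) hz
  rw [abs_lt]
  have h1 := key (-w) (by rwa [kroneckerXi_neg hd hd1])
  rw [neg_re] at h1
  exact ⟨by linarith, key w h⟩

theorem kroneckerXi_conj_eq_zero (hd : IsFundamentalDiscriminant (d : ℤ)) (hd1 : d ≠ 1)
    {w : ℂ} (h : kroneckerXi d hd w = 0) : kroneckerXi d hd ((starRingEnd ℂ) w) = 0 := by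
  have hw := (abs_lt.1 (abs_re_lt_of_kroneckerXi_eq_zero hd hd1 h)).1
  rw [kroneckerXi_eq_zero_iff hd hw] at h
  rw [kroneckerXi_eq_zero_iff hd (by rwa [conj_re])]
  have h1 := ZMod.LFunction_conj (kroneckerChar_conj hd) (sum_kroneckerChar hd hd1) (1 / 2 + w)
  have h2 : (starRingEnd ℂ) (1 / 2 + w) = 1 / 2 + (starRingEnd ℂ) w := by
    simp [map_ofNat]
  rw [h2] at h1
  refine h1.trans ?_
  rw [show ZMod.LFunction (kroneckerChar d hd) (1 / 2 + w) = 0 from h, map_zero]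

/-- Near `1/2` the factors relating `L` to the even function `ξ` are nonzero, so the order there
cannot be odd. Known zeros are therefore never at height `0`, and each has a mirror image distinct
from it. -/
theorem not_hasOddZeroAt_half (hd : IsFundamentalDiscriminant (d : ℤ)) (hd1 : d ≠ 1) :
    ¬ HasOddZeroAt (kroneckerChar d hd).LFunction (1 / 2) := by
  rintro ⟨m, hm, hord⟩
  have hdiff := DirichletCharacter.differentiable_LFunction (kroneckerChar_ne_one hd hd1)
  have han : AnalyticAt ℂ (kroneckerChar d hd).LFunction (1 / 2) := hdiff.analyticAt _
  obtain ⟨g, hg, hg0, hLg⟩ := (han.analyticOrderAt_eq_natCast).1 hord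
  have hd0 : (d : ℂ) ≠ 0 := NeZero.ne _
  have hG : Gammaℝ (1 / 2) ≠ 0 := Gammaℝ_ne_zero_of_re_pos (by simp)
  have hGc : ContinuousAt Gammaℝ (1 / 2) := by
    have h := (differentiable_Gammaℝ_inv (1 / 2)).continuousAt.inv₀ (inv_ne_zero hG)
    simpa only [Pi.inv_def, inv_inv] using h
  have hshift : Filter.Tendsto (fun w : ℂ => 1 / 2 + w) (nhds 0) (nhds (1 / 2)) := by
    have : Continuous fun w : ℂ => 1 / 2 + w := by fun_prop
    simpa using this.tendsto 0
  refine not_exists_odd_pow_mul_of_even (F := kroneckerXi d hd)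
    (H := fun w => (d : ℂ) ^ (w / 2) * (g (1 / 2 + w) * Gammaℝ (1 / 2 + w)))
    (kroneckerXi_neg hd hd1) hm ?_ ?_ ?_
  · have h1 : ContinuousAt (fun w : ℂ => (d : ℂ) ^ (w / 2)) 0 :=
      ContinuousAt.const_cpow (by fun_prop) (Or.inl hd0)
    have h2 : ContinuousAt (fun w : ℂ => g (1 / 2 + w)) 0 :=
      ContinuousAt.comp_of_eq hg.continuousAt (by fun_prop) (by simp)
    have h3 : ContinuousAt (fun w : ℂ => Gammaℝ (1 / 2 + w)) 0 :=
      ContinuousAt.comp_of_eq hGc (by fun_prop) (by simp)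
    exact h1.mul (h2.mul h3)
  · simp only [add_zero]
    exact mul_ne_zero (by simp) (mul_ne_zero hg0 hG)
  · filter_upwards [hshift.eventually hLg, (isOpen_lt continuous_const continuous_re).mem_nhds
      (show (-(1 / 2) : ℝ) < (0 : ℂ).re by norm_num)] with w hw hre
    rw [kroneckerXi, centeredXi_eq_LFunction_mul (kroneckerChar_even hd) hre,
      show ZMod.LFunction (kroneckerChar d hd) (1 / 2 + w) = _ from hw]
    simp only [add_sub_cancel_left, smul_eq_mul]
    ring

theorem re_logDeriv_kroneckerXi (hd : IsFundamentalDiscriminant (d : ℤ)) (hd1 : d ≠ 1) :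
    (logDeriv (kroneckerXi d hd) (3 / 2 : ℝ)).re =
      1 / 2 * Real.log (d / (Real.pi * Real.exp Real.eulerMascheroniConstant)) +
        (logDeriv (kroneckerChar d hd).LFunction 2).re := by
  have hχ := kroneckerChar_ne_one hd hd1
  have hL : (kroneckerChar d hd).LFunction 2 ≠ 0 :=
    DirichletCharacter.LFunction_ne_zero_of_one_le_re _ (Or.inl hχ) (by simp)
  have h := logDeriv_centeredXi (kroneckerChar_even hd)
    (DirichletCharacter.differentiable_LFunction hχ) hL
  have hd0 : (d : ℝ) ≠ 0 := NeZero.ne _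
  have hlog : Real.log (d / (Real.pi * Real.exp Real.eulerMascheroniConstant)) =
      Real.log d - Real.log Real.pi - Real.eulerMascheroniConstant := by
    rw [Real.log_div hd0 (mul_ne_zero Real.pi_ne_zero (Real.exp_ne_zero _)),
      Real.log_mul Real.pi_ne_zero (Real.exp_ne_zero _), Real.log_exp]
    ring
  have h32 : (((3 / 2 : ℝ)) : ℂ) = 3 / 2 := by push_cast; rfl
  rw [h32, kroneckerXi, h, logDeriv_Gammaℝ_two, hlog]
  have hcast : ((Real.log d : ℂ) / 2 +
      logDeriv (ZMod.LFunction (kroneckerChar d hd : ZMod d → ℂ)) 2 +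
      (-(Real.log Real.pi : ℂ) / 2 - Real.eulerMascheroniConstant / 2)) =
      ((Real.log d / 2 - Real.log Real.pi / 2 - Real.eulerMascheroniConstant / 2 : ℝ) : ℂ) +
        logDeriv (ZMod.LFunction (kroneckerChar d hd : ZMod d → ℂ)) 2 := by
    push_cast
    ring
  rw [hcast, add_re, ofReal_re]
  change _ + (logDeriv (kroneckerChar d hd).LFunction 2).re = _
  ring

/-- The explicit formula at `s = 2`, truncated to finitely many zeros in the upper half-plane. -/
theorem sum_zeros_kroneckerXi_le (hd : IsFundamentalDiscriminant (d : ℤ)) (hd1 : d ≠ 1)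
    (S : Finset ℂ) (hS : ∀ a ∈ S, kroneckerXi d hd a = 0 ∧ 0 < a.im) :
    ∑ a ∈ S, ((1 / ((3 / 2 : ℝ) - a)).re + (1 / ((3 / 2 : ℝ) + a)).re) ≤
      1 / 2 * Real.log (d / (Real.pi * Real.exp Real.eulerMascheroniConstant)) +
        (logDeriv (kroneckerChar d hd).LFunction 2).re := by
  have h0 := kroneckerChar_zero hd hd1
  obtain ⟨C, hC, hgrowth⟩ := exists_norm_centeredXi_le (kroneckerChar_even hd) h0
    (dft_kroneckerChar hd)
  rw [← re_logDeriv_kroneckerXi hd hd1]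
  exact sum_re_le_re_logDeriv_of_im_pos (differentiable_centeredXi h0 (dft_kroneckerChar hd))
    (kroneckerXi_neg hd hd1) hC hgrowth (by norm_num)
    (fun a ha => by linarith [abs_re_lt_of_kroneckerXi_eq_zero hd hd1 ha]) S hS

end Main

/-! ### Known zeros from the intervals, and the contradiction. -/

theorem HasOddZeroAt.apply_eq_zero {f : ℂ → ℂ} {z : ℂ} (h : HasOddZeroAt f z) : f z = 0 := by
  obtain ⟨m, hm, hord⟩ := h
  refine apply_eq_zero_of_analyticOrderAt_ne_zero ?_
  rw [hord]
  exact_mod_cast hm.pos.ne'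

open Complex in
theorem kroneckerXi_re_add_abs_im_eq_zero {d : ℕ} [NeZero d]
    (hd : IsFundamentalDiscriminant (d : ℤ)) (hd1 : d ≠ 1) {w : ℂ} (h : kroneckerXi d hd w = 0) :
    kroneckerXi d hd ((w.re : ℝ) + (|w.im| : ℝ) * I) = 0 := by
  rcases abs_choice w.im with h1 | h1
  · rwa [h1, re_add_im]
  · have : ((w.re : ℝ) + (|w.im| : ℝ) * I : ℂ) = (starRingEnd ℂ) w := by
      rw [h1]
      apply Complex.ext <;> simp
    rw [this]
    exact kroneckerXi_conj_eq_zero hd hd1 h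

open Complex in
theorem kroneckerXi_neg_re_add_abs_im_eq_zero {d : ℕ} [NeZero d]
    (hd : IsFundamentalDiscriminant (d : ℤ)) (hd1 : d ≠ 1) {w : ℂ} (h : kroneckerXi d hd w = 0) :
    kroneckerXi d hd ((-w.re : ℝ) + (|w.im| : ℝ) * I) = 0 := by
  have := kroneckerXi_re_add_abs_im_eq_zero hd hd1 (w := -w) (by rwa [kroneckerXi_neg hd hd1])
  rwa [neg_re, neg_im, abs_neg] at this

open Complex in
/-- The contribution of a set of intervals is bounded by that of finitely many distinct critical
zeros in the upper half-plane. -/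
theorem exists_finset_knownContribution_le {d : ℕ} [NeZero d]
    (hd : IsFundamentalDiscriminant (d : ℤ)) (hd1 : d ≠ 1) (Z : Set (NonemptyInterval ℝ))
    (hdisj : Z.PairwiseDisjoint (fun I => Set.Icc I.fst I.snd))
    (hzero : ∀ I ∈ Z, ∃ t ∈ Set.Icc I.fst I.snd,
      HasOddZeroAt (kroneckerChar d hd).LFunction (1 / 2 + t * Complex.I)) :
    ∃ T : Finset ℝ, (∀ u ∈ T, 0 < u ∧ kroneckerXi d hd ((0 : ℝ) + u * I) = 0) ∧
      knownContribution Z ≤ ∑ u ∈ T, 12 / (9 + 4 * u ^ 2) := by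
  classical
  choose! t ht hodd using hzero
  obtain ⟨A, hA, hAs⟩ := exists_finset_finsum_mem_eq {I ∈ Z | 0 ≤ I.fst}
    (fun I => 12 / (9 + 4 * I.snd ^ 2))
  obtain ⟨B, hB, hBs⟩ := exists_finset_finsum_mem_eq {I ∈ Z | I.fst = -I.snd}
    (fun I => 6 / (9 + 4 * I.snd ^ 2))
  have ht0 : ∀ I ∈ Z, t I ≠ 0 := fun I hI h0 => by
    have := hodd I hI
    rw [h0, ofReal_zero, zero_mul, add_zero] at this
    exact not_hasOddZeroAt_half hd hd1 this
  -- An interval of both kinds could only be `{0}`, whose zero would be at height `0`.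
  have hAB : Disjoint A B := by
    rw [Finset.disjoint_left]
    intro I h1 h2
    have h3 := hA h1
    have h4 := hB h2
    have h5 := ht I h3.1
    refine ht0 I h3.1 (le_antisymm ?_ ?_)
    · have := h3.2
      have := h4.2
      linarith [h5.2]
    · exact h3.2.trans h5.1
  -- Either form of interval contains `|t|` along with `t`. Disjointness thus makes the heights `|t
  -- I|` distinct even after reflection into the upper half-plane.
  have hmem : ∀ I ∈ A ∪ B, I ∈ Z ∧ |t I| ∈ Set.Icc I.fst I.snd := by
    intro I hI
    rcases Finset.mem_union.1 hI with h | h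
    · have h3 := hA h
      have h5 := ht I h3.1
      refine ⟨h3.1, ?_⟩
      rwa [abs_of_nonneg (h3.2.trans h5.1)]
    · have h3 := hB h
      have h5 := ht I h3.1
      have h6 := h3.2
      have h7 : |t I| ≤ I.snd := abs_le.2 ⟨h6 ▸ h5.1, h5.2⟩
      exact ⟨h3.1, by linarith [abs_nonneg (t I)], h7⟩
  have hinj : Set.InjOn (fun I => |t I|) ((A ∪ B : Finset _) : Set (NonemptyInterval ℝ)) := by
    intro I hI J hJ hIJ
    by_contra hne
    have h1 := hmem I hI
    have h2 := hmem J hJ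
    refine Set.disjoint_left.1 (hdisj h1.1 h2.1 hne) h1.2 ?_
    rw [show |t I| = |t J| from hIJ]
    exact h2.2
  have hle : ∀ I ∈ A ∪ B, (12 : ℝ) / (9 + 4 * I.snd ^ 2) ≤ 12 / (9 + 4 * |t I| ^ 2) := by
    intro I hI
    have := (hmem I hI).2.2
    gcongr
  refine ⟨(A ∪ B).image fun I => |t I|, ?_, ?_⟩
  · intro u hu
    obtain ⟨I, hI, rfl⟩ := Finset.mem_image.1 hu
    have hIZ := (hmem I hI).1
    refine ⟨abs_pos.2 (ht0 I hIZ), ?_⟩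
    have h0 := (hodd I hIZ).apply_eq_zero
    rw [← kroneckerXi_eq_zero_iff hd (by simp)] at h0
    simpa using kroneckerXi_re_add_abs_im_eq_zero hd hd1 h0
  · rw [Finset.sum_image hinj, Finset.sum_union hAB, knownContribution, hAs, hBs]
    refine add_le_add (Finset.sum_le_sum fun I hI => hle I (Finset.mem_union_left _ hI))
      (Finset.sum_le_sum fun I hI => le_trans ?_ (hle I (Finset.mem_union_right _ hI)))
    -- A symmetric interval is credited with `6`, although its zero also contributes with numerator
    -- `12`.
    gcongr
    norm_num

open Complex in
theorem mainTheorem5 (d : ℕ) [NeZero d] (hd : IsFundamentalDiscriminant (d : ℤ)) (hd1 : d ≠ 1)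
    (τ : ℝ) (hτ : 0 < τ)
    (Z : Set (NonemptyInterval ℝ))
    (hZ : ∀ I ∈ Z, IsAdmissibleInterval τ I)
    (hdisj : Z.PairwiseDisjoint (fun I => Set.Icc I.fst I.snd))
    (hzero : ∀ I ∈ Z, ∃ t ∈ Set.Icc I.fst I.snd,
      HasOddZeroAt (kroneckerChar d hd).LFunction (1 / 2 + t * Complex.I))
    (η : ℝ) (hη : 0 < η)
    (h : 2 * iotaMin η + knownContribution Z >
      1 / 2 * Real.log (d / (Real.pi * Real.exp Real.eulerMascheroniConstant)) +
        (logDeriv (kroneckerChar d hd).LFunction 2).re) :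
    ∀ ρ : ℂ, IsNontrivialZero (kroneckerChar d hd) ρ → 0 < |ρ.im| → |ρ.im| ≤ η →
      ρ.re = 1 / 2 := by
  intro ρ hρ him hle
  by_contra hre
  obtain ⟨T, hT, hTle⟩ := exists_finset_knownContribution_le hd hd1 Z hdisj hzero
  obtain ⟨w, hw⟩ : ∃ w : ℂ, w = ρ - 1 / 2 := ⟨_, rfl⟩
  have hwre : w.re = ρ.re - 1 / 2 := by simp [hw]
  have hwim : w.im = ρ.im := by simp [hw]
  have hw0 : kroneckerXi d hd w = 0 := by
    rw [kroneckerXi_eq_zero_iff hd (by rw [hwre]; linarith [hρ.2.1]), hw, add_sub_cancel]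
    exact hρ.1
  have hx := abs_re_lt_of_kroneckerXi_eq_zero hd hd1 hw0
  have hp := kroneckerXi_re_add_abs_im_eq_zero hd hd1 hw0
  have hq := kroneckerXi_neg_re_add_abs_im_eq_zero hd hd1 hw0
  rw [hwim] at hp hq
  have hx0 : w.re ≠ 0 := by
    rw [hwre]
    exact sub_ne_zero.2 hre
  generalize w.re = x at hx hp hq hx0
  generalize |ρ.im| = g at him hle hp hq
  have hpt : Function.Injective fun z : ℝ × ℝ => ((z.1 : ℂ) + z.2 * I) := by
    intro y z hyz
    have h1 := congrArg re hyz
    have h2 := congrArg im hyz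
    simp at h1 h2
    exact Prod.ext h1 h2
  -- The truncated explicit formula is applied to `±x + ig` and all the `iu`; these points are
  -- distinct because `x ≠ 0`. Pairs of reals index them so that the sum can be split.
  have hS := sum_zeros_kroneckerXi_le hd hd1
    ((insert (x, g) (insert (-x, g) (T.image fun u => ((0 : ℝ), u)))).image
      fun z : ℝ × ℝ => ((z.1 : ℂ) + z.2 * I)) (by
    intro a ha
    obtain ⟨z, hz, rfl⟩ := Finset.mem_image.1 ha
    rcases Finset.mem_insert.1 hz with rfl | hz
    · exact ⟨hp, by simpa using him⟩
    rcases Finset.mem_insert.1 hz with rfl | hz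
    · exact ⟨hq, by simpa using him⟩
    · obtain ⟨u, hu, rfl⟩ := Finset.mem_image.1 hz
      exact ⟨(hT u hu).2, by simpa using (hT u hu).1⟩)
  rw [Finset.sum_image hpt.injOn, Finset.sum_insert, Finset.sum_insert, Finset.sum_image] at hS
  · simp only [re_one_div_sub, re_one_div_add] at hS
    have h1 := (iotaMin_anti him.le hle).trans (iotaMin_le hx (b := g))
    have h2 := (iotaMin_anti him.le hle).trans (iotaMin_le (x := -x) (by rwa [abs_neg]) (b := g))
    have h3 : ∑ u ∈ T, ((3 / 2 - 0) / ((3 / 2 - 0) ^ 2 + u ^ 2) +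
        (3 / 2 + 0) / ((3 / 2 + 0) ^ 2 + u ^ 2)) = ∑ u ∈ T, 12 / (9 + 4 * u ^ 2) := by
      refine Finset.sum_congr rfl fun u _ => ?_
      have : (0 : ℝ) < 9 + 4 * u ^ 2 := by positivity
      have : (0 : ℝ) < (3 / 2) ^ 2 + u ^ 2 := by positivity
      rw [sub_zero, add_zero]
      field_simp
      ring
    linarith
  · intro a _ b _ hab
    exact (Prod.ext_iff.1 hab).2
  · simp [hx0]
  · simp [hx0, hx0.symm, self_eq_neg]
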